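/- Let $K_v$ be the complete graph on $v$ vertices, where $v$ is a positive integer with $v\neq 2$. A $1$-factor of $K_v$ is a perfect matching, and $K_v-I$ denotes $K_v$ with the edges of the $1$-factor $I$ removed. For a graph $H$, an $H$-factor of a graph $G$ is a collection of subgraphs of $G$ (blocks), each isomorphic to $H$, such that every vertex of $G$ lies in exactly one block. A graph $G$ can be decomposed into $H$-factors if there are finitely many $H$-factors of $G$ such that every edge of $G$ lies in exactly one block of exactly one of them. A $5$-star is the complete bipartite graph $K_{1,5}$. A $(K_2,K_{1,5})$-URD$(v;r,s)$ is a decomposition of $K_v$ into $r$ $K_2$-factors and $s$ $K_{1,5}$-factors, every edge of $K_v$ lying in exactly one block of exactly one of these factors. Then: 1. There is a $1$-factor $I$ of $K_v$ such that $K_v-I$ can be decomposed into $K_{1,5}$-factors if and only if $v\equiv 12\pmod{30}$. 2. For every $1$-factor $I$ of $K_v$, the graph $K_v-I$ can be decomposed into $K_{1,5}$-factors if and only if $v\equiv 12\pmod{30}$. 3. For every integer $s\ge 0$, a $(K_2,K_{1,5})$-URD$(v;1,s)$ exists if and only if $v\equiv 12\pmod{30}$ and $s=\frac{3(v-2)}{5}$.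 -/

import Mathlib

/-- An `H`-factor (uniform resolution class) of `G`: a family of subgraphs of `G` (the blocks), each
isomorphic to `H`, such that every vertex of `G` lies in exactly one block. -/
def IsGraphFactor {V W : Type*} (G : SimpleGraph V) (H : SimpleGraph W)
    (F : Set G.Subgraph) : Prop :=
  (∀ B ∈ F, Nonempty (B.coe ≃g H)) ∧ ∀ x : V, ∃! B : G.Subgraph, B ∈ F ∧ x ∈ B.verts

/-- The classes `F i` decompose `G`: every edge of `G` lies in exactly one block of exactly one
class. -/
def DecomposesEdges {V ι : Type*} (G : SimpleGraph V) (F : ι → Set G.Subgraph) : Prop :=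
  ∀ e ∈ G.edgeSet, ∃! p : ι × G.Subgraph, p.2 ∈ F p.1 ∧ e ∈ p.2.edgeSet

/-- `G` has an `H`-factorization: it can be decomposed into finitely many `H`-factors. -/
def HasGraphFactorization {V W : Type*} (G : SimpleGraph V) (H : SimpleGraph W) : Prop :=
  ∃ (s : ℕ) (F : Fin s → Set G.Subgraph), (∀ j, IsGraphFactor G H (F j)) ∧ DecomposesEdges G F

/-- An `(H₁, H₂)`-URD`(v; r, s)` exists: the complete graph on `v` vertices has a resolvable
decomposition into `r` classes consisting of copies of `H₁` and `s` classes consisting of copies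
of `H₂`. -/
def ExistsURD {W₁ W₂ : Type*} (H₁ : SimpleGraph W₁) (H₂ : SimpleGraph W₂) (v r s : ℕ) : Prop :=
  ∃ F : Fin r ⊕ Fin s → Set (SimpleGraph.completeGraph (Fin v)).Subgraph,
    (∀ i : Fin r, IsGraphFactor (SimpleGraph.completeGraph (Fin v)) H₁ (F (Sum.inl i))) ∧
    (∀ j : Fin s, IsGraphFactor (SimpleGraph.completeGraph (Fin v)) H₂ (F (Sum.inr j))) ∧
    DecomposesEdges (SimpleGraph.completeGraph (Fin v)) F

/-- The `n`-star `K_{1,n}`. -/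
abbrev nStar (n : ℕ) : SimpleGraph (Fin 1 ⊕ Fin n) := completeBipartiteGraph (Fin 1) (Fin n)

/-- `K_v - I`: the complete graph on `v` vertices with the edges of its subgraph `I` removed. -/
abbrev completeMinus {v : ℕ} (I : (SimpleGraph.completeGraph (Fin v)).Subgraph) : SimpleGraph (Fin v) :=
  (SimpleGraph.completeGraph (Fin v)).deleteEdges I.edgeSet

/-! Necessity is a count. If `s > 0`, each star factor has `v/6` blocks with five edges each, and
`K_v - I` has `v(v-2)/2` edges. So `3(v-2) = 5s` and `6 ∣ v`, which gives `v ≡ 12 (mod 30)`. If `s =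
0` there are no edges, which leaves only the excluded `v = 2`.

For sufficiency, write `v = 30k + 12`. A star factor is encoded by the map sending each vertex to
the center of its block, and a decomposition by such maps together with the function giving the
factor of each edge (`IsDesign`). All perfect matchings of `K_v` are conjugate, so one design on `v`
vertices serves every `I`.

The design comes from a holed design on `30k + 12` vertices: no edges inside a 12-point hole, six
factors avoiding the hole and `18k` covering everything. The six are completed on the hole by the
six factors of an explicit decomposition of `K_12 - I` (`isDesign_fin_twelve`,
`HasHoledDesign.hasStarDesign`).

Holed designs are multiplied (`HasHoledDesign.mul`). A frame on `u` parts of size `30k` has factors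
that each miss one part, `18k` for each part. Placing a holed design on every part, all sharing the
hole, completes the frame factors (`IsDesign.fill`). Frames come from commutative quasigroups with
holes: for a fixed `r`, the pairs `{p, q}` with product `r` match up the points outside the part of
`r`, and on each pair one puts a star factor of `K_{30,30}` (`isDesign_frame`).

Midpoints in `Z_u` for odd `u`, and a quasigroup of order 8 with four holes, reduce every `k` to 1,
2 and 4 (`hasHoledDesign_of_base`). These three holed designs and the decomposition of `K_{30,30}`
are explicit, with cyclic symmetry, and are verified by computation. -/

/-! ### Star factors encoded by center maps. -/

/-- `c` sends every vertex to the center of its block, and the block containing `x` is a star with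
`n` leaves. -/
def StarAt {V : Type*} (n : ℕ) (c : V → V) (x : V) : Prop :=
  c (c x) = c x ∧ {y | c y = c x}.ncard = n + 1

/-- By `hr` no point outside the range of `f` is sent into it, so the fibers of `d` over the range
are the images of fibers of `c`. -/
theorem StarAt.of_embedding {V W : Type*} {n : ℕ} {c : V → V} {d : W → W} {f : V → W} {x : V}
    (h : StarAt n c x) (hf : Function.Injective f) (hcd : ∀ y, d (f y) = f (c y))
    (hr : ∀ w, d w ∈ Set.range f → w ∈ Set.range f) : StarAt n d (f x) := by
  refine ⟨by rw [hcd, hcd, h.1], ?_⟩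
  rw [← h.2, ← Set.ncard_image_of_injective _ hf]
  congr 1
  ext w
  simp only [Set.mem_ofPred_eq, Set.mem_image]
  constructor
  · intro hw
    obtain ⟨y, rfl⟩ := hr w (by rw [hw, hcd]; exact ⟨_, rfl⟩)
    exact ⟨y, hf (by rw [← hcd, ← hcd, hw]), rfl⟩
  · rintro ⟨y, hy, rfl⟩
    rw [hcd, hcd, hy]

theorem StarAt.of_equiv {V W : Type*} {n : ℕ} {c : V → V} (e : V ≃ W) {x : V}
    (h : StarAt n c x) : StarAt n (fun w => e (c (e.symm w))) (e x) :=
  h.of_embedding e.injective (by simp) (by simp)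

/-- The star with center `z` determined by the center map `c`. -/
def starBlock {V : Type*} (G : SimpleGraph V) (c : V → V) (hc : ∀ x, c x ≠ x → G.Adj x (c x))
    (z : V) : G.Subgraph where
  verts := {x | c x = z}
  Adj x y := c x = z ∧ c y = z ∧ x ≠ y ∧ (x = z ∨ y = z)
  adj_sub := by
    rintro x y ⟨hx, hy, hne, rfl | rfl⟩
    · have := hc y (by rw [hy]; exact hne)
      rw [hy] at this
      exact this.symm
    · have := hc x (by rw [hx]; exact hne.symm)
      rwa [hx] at this
  edge_vert := fun h => h.1
  symm := ⟨fun x y ⟨hx, hy, hne, h⟩ => ⟨hy, hx, hne.symm, h.symm⟩⟩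

theorem nonempty_starBlock_iso {V : Type*} [Finite V] (G : SimpleGraph V) (c : V → V)
    (hc : ∀ x, c x ≠ x → G.Adj x (c x)) {z : V} (hz : c z = z) {n : ℕ} (hs : StarAt n c z) :
    Nonempty ((starBlock G c hc z).coe ≃g nStar n) := by
  classical
  let W := {x | c x = z}
  let z' : W := ⟨z, hz⟩
  have hW : Nat.card W = n + 1 := by
    have := hs.2
    rw [hz] at this
    exact this
  have hcard : Nat.card {x : W // ¬ x = z'} = n := by
    have h1 := Nat.card_congr (Equiv.sumCompl (fun x : W => x = z'))
    rw [Nat.card_sum, hW] at h1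
    simp only [Nat.card_unique] at h1
    omega
  obtain ⟨e⟩ : Nonempty ({x : W // ¬ x = z'} ≃ Fin n) := ⟨Finite.equivFinOfCardEq hcard⟩
  let E : W ≃ Fin 1 ⊕ Fin n := (Equiv.sumCompl (fun x : W => x = z')).symm.trans
    (Equiv.sumCongr (Equiv.ofUnique _ _) e)
  have hl : ∀ x : W, (E x).isLeft = true ↔ x = z' := by
    intro x
    by_cases hx : x = z'
    · simp [E, hx, Equiv.sumCompl_symm_apply_of_pos]
    · simp [E, hx, Equiv.sumCompl_symm_apply_of_neg]
  have hr : ∀ x : W, (E x).isRight = true ↔ x ≠ z' := by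
    intro x
    rw [← Sum.not_isLeft, Ne, ← hl]
  have key : ∀ x y : W, ((E x).isLeft = true ∧ (E y).isRight = true ∨
      (E x).isRight = true ∧ (E y).isLeft = true) ↔
      (c x.1 = z ∧ c y.1 = z ∧ x.1 ≠ y.1 ∧ (x.1 = z ∨ y.1 = z)) := by
    rintro ⟨x, hx⟩ ⟨y, hy⟩
    rw [hl, hr, hl, hr]
    have hx : c x = z := hx
    have hy : c y = z := hy
    simp only [z', hx, hy, true_and, Subtype.mk.injEq, ne_eq]
    constructor
    · rintro (⟨rfl, h⟩ | ⟨h, rfl⟩)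
      · exact ⟨fun h' => h h'.symm, Or.inl rfl⟩
      · exact ⟨h, Or.inr rfl⟩
    · rintro ⟨h, rfl | rfl⟩
      · exact Or.inl ⟨rfl, fun h' => h h'.symm⟩
      · exact Or.inr ⟨h, rfl⟩
  exact ⟨⟨E, fun {x y} => key x y⟩⟩

/-- The blocks of the factor with center map `c`. -/
def starFactor {V : Type*} (G : SimpleGraph V) (c : V → V)
    (hc : ∀ x, c x ≠ x → G.Adj x (c x)) : Set G.Subgraph :=
  {B | ∃ z, c z = z ∧ B = starBlock G c hc z}

theorem isGraphFactor_starFactor {V : Type*} [Finite V] (G : SimpleGraph V) (c : V → V)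
    (hc : ∀ x, c x ≠ x → G.Adj x (c x)) {n : ℕ} (hs : ∀ x, StarAt n c x) :
    IsGraphFactor G (nStar n) (starFactor G c hc) := by
  refine ⟨?_, fun x => ⟨starBlock G c hc (c x), ⟨⟨c x, (hs x).1, rfl⟩, rfl⟩, ?_⟩⟩
  · rintro _ ⟨z, hz, rfl⟩
    exact nonempty_starBlock_iso G c hc hz (hs z)
  · rintro _ ⟨⟨z, hz, rfl⟩, hx⟩
    have hx : c x = z := hx
    rw [hx]

/-- One end of an edge of a star is its center. So `xy` is covered by factor `i` exactly when `c i`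
sends one end to the other, and that end determines the block. -/
theorem decomposesEdges_starFactor {V ι : Type*} (G : SimpleGraph V) (c : ι → V → V)
    (hc : ∀ i x, c i x ≠ x → G.Adj x (c i x)) (hi : ∀ i x, c i (c i x) = c i x)
    (hu : ∀ x y, G.Adj x y → ∃! i, c i x = y ∨ c i y = x) :
    DecomposesEdges G fun i => starFactor G (c i) (hc i) := by
  intro e
  induction e with | _ x y => ?_
  intro hxy
  rw [SimpleGraph.mem_edgeSet] at hxy
  obtain ⟨i, hi1, hi2⟩ := hu x y hxy
  have hne := hxy.ne
  have key : ∀ j z, c j z = z → (s(x, y) ∈ (starBlock G (c j) (hc j) z).edgeSet ↔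
      (c j x = y ∧ z = y ∨ c j y = x ∧ z = x)) := by
    intro j z hz
    rw [SimpleGraph.Subgraph.mem_edgeSet]
    change (c j x = z ∧ c j y = z ∧ x ≠ y ∧ (x = z ∨ y = z)) ↔ _
    constructor
    · rintro ⟨h1, h2, -, rfl | rfl⟩
      · exact Or.inr ⟨h2, rfl⟩
      · exact Or.inl ⟨h1, rfl⟩
    · rintro (⟨h1, rfl⟩ | ⟨h1, rfl⟩)
      · exact ⟨h1, hz, hne, Or.inr rfl⟩
      · exact ⟨hz, h1, hne, Or.inl rfl⟩
  have uniq : ∀ j z, c j z = z → s(x, y) ∈ (starBlock G (c j) (hc j) z).edgeSet →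
      j = i ∧ z = c i x := by
    intro j z hz h
    rw [key j z hz] at h
    obtain rfl : j = i := hi2 j (by tauto)
    rcases h with ⟨h1, rfl⟩ | ⟨h1, rfl⟩
    · exact ⟨rfl, h1.symm⟩
    · exact ⟨rfl, hz.symm⟩
  refine ⟨(i, starBlock G (c i) (hc i) (c i x)), ⟨⟨_, hi i x, rfl⟩, ?_⟩, ?_⟩
  · rw [key i _ (hi i x)]
    rcases hi1 with h | h
    · exact Or.inl ⟨h, h⟩
    · exact Or.inr ⟨h, by rw [← h, hi]⟩
  · rintro ⟨j, B⟩ ⟨⟨z, hz, hB⟩, he⟩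
    change c j z = z at hz
    obtain rfl : B = starBlock G (c j) (hc j) z := hB
    obtain ⟨rfl, rfl⟩ := uniq j z hz he
    rfl

/-! ### Counting vertices and edges: the necessary conditions. -/

theorem IsGraphFactor.ncard_mul {V W : Type*} [Finite V] {G : SimpleGraph V} {H : SimpleGraph W}
    {F : Set G.Subgraph} (hF : IsGraphFactor G H F) : F.ncard * Nat.card W = Nat.card V := by
  classical
  have := Fintype.ofFinite V
  have := Fintype.ofFinite F
  let φ : (Σ B : F, B.1.verts) → V := fun p => p.2.1
  have hφ : Function.Bijective φ := by
    constructor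
    · rintro ⟨⟨B, hB⟩, ⟨x, hx⟩⟩ ⟨⟨B', hB'⟩, ⟨x', hx'⟩⟩ h
      change x = x' at h
      subst h
      obtain rfl := (hF.2 x).unique ⟨hB, hx⟩ ⟨hB', hx'⟩
      rfl
    · intro x
      obtain ⟨B, ⟨hB, hx⟩, -⟩ := hF.2 x
      exact ⟨⟨⟨B, hB⟩, ⟨x, hx⟩⟩, rfl⟩
  rw [← Nat.card_congr (Equiv.ofBijective φ hφ), Nat.card_sigma]
  rw [Finset.sum_congr rfl (fun B _ => Nat.card_congr (hF.1 B.1 B.2).some.toEquiv)]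
  rw [Finset.sum_const, smul_eq_mul, Finset.card_univ, ← Nat.card_eq_fintype_card,
    Nat.card_coe_set_eq]

theorem DecomposesEdges.card_edgeSet {V ι : Type*} [Finite V] [Fintype ι] {G : SimpleGraph V}
    {F : ι → Set G.Subgraph} (hd : DecomposesEdges G F) (m : ι → ℕ)
    (hm : ∀ i, ∀ B ∈ F i, Nat.card B.edgeSet = m i) :
    Nat.card G.edgeSet = ∑ i, (F i).ncard * m i := by
  classical
  have := Fintype.ofFinite V
  have hfin : ∀ i, Finite (F i) := fun i => inferInstance
  have := fun i => Fintype.ofFinite (F i)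
  let φ : (Σ i : ι, Σ B : F i, B.1.edgeSet) → G.edgeSet :=
    fun p => ⟨p.2.2.1, p.2.1.1.edgeSet_subset p.2.2.2⟩
  have hφ : Function.Bijective φ := by
    constructor
    · rintro ⟨i, ⟨B, hB⟩, ⟨e, he⟩⟩ ⟨i', ⟨B', hB'⟩, ⟨e', he'⟩⟩ h
      have h : e = e' := congrArg Subtype.val h
      subst h
      have := (hd e (B.edgeSet_subset he)).unique (y₁ := (i, B)) (y₂ := (i', B'))
        ⟨hB, he⟩ ⟨hB', he'⟩
      cases this
      rfl
    · rintro ⟨e, he⟩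
      obtain ⟨⟨i, B⟩, ⟨hB, heB⟩, -⟩ := hd e he
      exact ⟨⟨i, ⟨B, hB⟩, ⟨e, heB⟩⟩, rfl⟩
  rw [← Nat.card_congr (Equiv.ofBijective φ hφ), Nat.card_sigma]
  refine Finset.sum_congr rfl fun i _ => ?_
  rw [Nat.card_sigma, Finset.sum_congr rfl (fun B _ => hm i B.1 B.2)]
  rw [Finset.sum_const, smul_eq_mul, Finset.card_univ, ← Nat.card_eq_fintype_card,
    Nat.card_coe_set_eq]

theorem card_subgraph_edgeSet_of_iso {V W : Type*} {G : SimpleGraph V} {H : SimpleGraph W}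
    (B : G.Subgraph) (e : B.coe ≃g H) : Nat.card B.edgeSet = Nat.card H.edgeSet := by
  rw [← Nat.card_congr e.mapEdgeSet, ← SimpleGraph.Subgraph.image_coe_edgeSet_coe]
  exact Nat.card_image_of_injective (Sym2.map.injective Subtype.val_injective) _

theorem card_edgeSet_nStar (n : ℕ) : Nat.card (nStar n).edgeSet = n := by
  let φ : Fin n → (nStar n).edgeSet := fun j => ⟨s(Sum.inl 0, Sum.inr j), by simp⟩
  have hφ : Function.Bijective φ := by
    constructor
    · intro i j h
      simpa [φ] using h
    · rintro ⟨e, he⟩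
      induction e with | _ x y => ?_
      rcases x with x | x <;> rcases y with y | y <;> simp at he
      · exact ⟨y, Subtype.ext (by simp [φ, Subsingleton.elim x 0])⟩
      · exact ⟨x, Subtype.ext (by simp [φ, Subsingleton.elim y 0])⟩
  rw [← Nat.card_congr (Equiv.ofBijective φ hφ), Nat.card_fin]

/-- Reading `K_2` as `K_{1,1}` lets the star machinery handle the 1-factor as well. -/
theorem nonempty_completeGraph_two_iso :
    Nonempty (nStar 1 ≃g SimpleGraph.completeGraph (Fin 2)) :=
  ⟨⟨finSumFinEquiv, fun {a b} => by revert a b; simp⟩⟩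

theorem IsGraphFactor.of_iso {V W W' : Type*} {G : SimpleGraph V} {H : SimpleGraph W}
    {H' : SimpleGraph W'} {F : Set G.Subgraph} (hF : IsGraphFactor G H F) (e : H ≃g H') :
    IsGraphFactor G H' F :=
  ⟨fun B hB => (hF.1 B hB).map fun f => f.trans e, hF.2⟩

theorem card_edgeSet_completeGraph (v : ℕ) :
    2 * Nat.card (SimpleGraph.completeGraph (Fin v)).edgeSet = v * (v - 1) := by
  classical
  rw [Nat.card_eq_fintype_card, ← SimpleGraph.edgeFinset_card,
    ← SimpleGraph.sum_degrees_eq_twice_card_edges]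
  simp

theorem SimpleGraph.Subgraph.IsPerfectMatching.exists_involution {V : Type*} {G : SimpleGraph V}
    {I : G.Subgraph} (hI : I.IsPerfectMatching) :
    ∃ σ : V → V, (∀ x, σ (σ x) = x) ∧ (∀ x, σ x ≠ x) ∧ ∀ x y, I.Adj x y ↔ y = σ x := by
  rw [SimpleGraph.Subgraph.isPerfectMatching_iff] at hI
  choose σ h1 h2 using hI
  exact ⟨σ, fun x => (h2 _ _ (I.symm.symm _ _ (h1 x))).symm, fun x => (I.adj_sub (h1 x)).ne',
    fun x y => ⟨fun h => h2 x y h, fun h => h ▸ h1 x⟩⟩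

theorem completeMinus_adj {v : ℕ} {I : (SimpleGraph.completeGraph (Fin v)).Subgraph}
    {σ : Fin v → Fin v} (h : ∀ x y, I.Adj x y ↔ y = σ x) (x y : Fin v) :
    (completeMinus I).Adj x y ↔ x ≠ y ∧ y ≠ σ x := by
  simp [SimpleGraph.deleteEdges_adj, SimpleGraph.completeGraph, h]

theorem card_edgeSet_completeMinus {v : ℕ} {I : (SimpleGraph.completeGraph (Fin v)).Subgraph}
    (hI : I.IsPerfectMatching) : 2 * Nat.card (completeMinus I).edgeSet = v * (v - 2) := by
  classical
  obtain ⟨σ, -, hne, hσ⟩ := hI.exists_involution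
  rw [Nat.card_eq_fintype_card, ← SimpleGraph.edgeFinset_card,
    ← SimpleGraph.sum_degrees_eq_twice_card_edges]
  have : ∀ x, (completeMinus I).degree x = v - 2 := by
    intro x
    have h : (completeMinus I).neighborFinset x = (Finset.univ.erase x).erase (σ x) := by
      ext y
      rw [SimpleGraph.mem_neighborFinset, completeMinus_adj hσ]
      simp [and_comm, eq_comm]
    rw [← SimpleGraph.card_neighborFinset_eq_degree, h, Finset.card_erase_of_mem (by simp [hne]),
      Finset.card_erase_of_mem (by simp), Finset.card_univ, Fintype.card_fin]
    omega
  simp [this]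

/-- Here `q` is the number of blocks in a star factor. Cancelling `q` from the edge count leaves
`3(v-2) = 5s`. With `s = 0` the count forces `v = 0` or `v = 2`. -/
theorem modEq_of_card_equation {v s q : ℕ} (hv2 : v ≠ 2) (hv : 0 < v) (he : Even v)
    (hq : 0 < s → q * 6 = v) (h : v * (v - 2) = 2 * (s * (q * 5))) :
    v ≡ 12 [MOD 30] ∧ 5 * s + 6 = 3 * v := by
  rw [Nat.even_iff] at he
  rcases Nat.eq_zero_or_pos s with rfl | hs
  · simp at h
    omega
  obtain rfl := hq hs
  have hq0 : 0 < q := by omega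
  obtain ⟨w, hw⟩ : ∃ w, q * 6 = w + 2 := ⟨q * 6 - 2, by omega⟩
  rw [hw, Nat.add_sub_cancel, ← hw] at h
  have : 6 * w = 10 * s := Nat.eq_of_mul_eq_mul_left hq0 (by linarith)
  rw [Nat.ModEq]
  omega

theorem modEq_of_hasGraphFactorization {v : ℕ} (hv : 0 < v) (hv2 : v ≠ 2)
    {I : (SimpleGraph.completeGraph (Fin v)).Subgraph} (hI : I.IsPerfectMatching)
    (h : HasGraphFactorization (completeMinus I) (nStar 5)) : v ≡ 12 [MOD 30] := by
  obtain ⟨s, F, hF, hd⟩ := h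
  have hE := hd.card_edgeSet (fun _ => 5) fun i B hB => by
    obtain ⟨e⟩ := (hF i).1 B hB
    rw [card_subgraph_edgeSet_of_iso B e, card_edgeSet_nStar]
  have hc : ∀ i, (F i).ncard = v / 6 ∧ v / 6 * 6 = v := by
    intro i
    have := (hF i).ncard_mul
    simp at this
    omega
  simp only [(hc _).1, Finset.sum_const, Finset.card_univ, Fintype.card_fin, smul_eq_mul] at hE
  have he : Even v := by
    classical
    have := hI.even_card
    rwa [Fintype.card_fin] at this
  refine (modEq_of_card_equation (s := s) (q := v / 6) hv2 hv he (fun hs => (hc ⟨0, hs⟩).2) ?_).1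
  rw [← hE, card_edgeSet_completeMinus hI]

theorem modEq_of_existsURD {v s : ℕ} (hv : 0 < v) (hv2 : v ≠ 2)
    (h : ExistsURD (SimpleGraph.completeGraph (Fin 2)) (nStar 5) v 1 s) :
    v ≡ 12 [MOD 30] ∧ 5 * s + 6 = 3 * v := by
  obtain ⟨F, h2, h5, hd⟩ := h
  have hE := hd.card_edgeSet (Sum.elim (fun _ => 1) fun _ => 5) fun i B hB => by
    rcases i with i | i
    · obtain ⟨e⟩ := (h2 i).1 B hB
      obtain ⟨e'⟩ := nonempty_completeGraph_two_iso
      rw [card_subgraph_edgeSet_of_iso B (e.trans e'.symm), card_edgeSet_nStar]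
      rfl
    · obtain ⟨e⟩ := (h5 i).1 B hB
      rw [card_subgraph_edgeSet_of_iso B e, card_edgeSet_nStar]
      rfl
  have hc : ∀ i, (F (Sum.inr i)).ncard = v / 6 ∧ v / 6 * 6 = v := by
    intro i
    have := (h5 i).ncard_mul
    simp at this
    omega
  have hc2 : (F (Sum.inl 0)).ncard * 2 = v := by
    have := (h2 0).ncard_mul
    simpa using this
  simp only [Fintype.sum_sum_type, Sum.elim_inl, Sum.elim_inr, (hc _).1, Finset.sum_const,
    Finset.card_univ, Fintype.card_fin, smul_eq_mul, Fin.sum_univ_one] at hE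
  refine modEq_of_card_equation (q := v / 6) hv2 hv ⟨(F (Sum.inl 0)).ncard, by omega⟩
    (fun hs => (hc ⟨0, hs⟩).2) ?_
  have hv' := card_edgeSet_completeGraph v
  rw [hE] at hv'
  obtain ⟨w, rfl⟩ : ∃ w, v = w + 2 := ⟨v - 2, by omega⟩
  simp only [Nat.add_sub_cancel, show w + 2 - 1 = w + 1 by omega] at hv' ⊢
  nlinarith

/-! ### Designs, and their transport to an arbitrary perfect matching. -/

/-- `c` is a family of (partial) 5-star factors, the `i`-th one on the vertex set `A i`, such that
every pair of vertices satisfying `R` is an edge of the factor of index `col x y` and of no other. -/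
structure IsDesign {V ι : Type*} (R : V → V → Prop) (A : ι → Set V) (c : ι → V → V)
    (col : V → V → ι) : Prop where
  fixed : ∀ i x, x ∉ A i → c i x = x
  mem : ∀ i x, x ∈ A i → c i x ∈ A i
  star : ∀ i x, x ∈ A i → StarAt 5 (c i) x
  adj : ∀ i x, c i x ≠ x → R x (c i x) ∧ col x (c i x) = i ∧ col (c i x) x = i
  link : ∀ x y, R x y → c (col x y) x = y ∨ c (col x y) y = x

/-- The vertices `x` and `y` are distinct and not matched by `σ`. -/
def Unmatched {V : Type*} (σ : V → V) (x y : V) : Prop := x ≠ y ∧ y ≠ σ x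

theorem IsDesign.idem {V ι : Type*} {R : V → V → Prop} {A : ι → Set V} {c : ι → V → V}
    {col : V → V → ι} (h : IsDesign R A c col) (i : ι) (x : V) : c i (c i x) = c i x := by
  by_cases hx : x ∈ A i
  · exact (h.star i x hx).1
  · rw [h.fixed i x hx, h.fixed i x hx]

/-- Existence is `link`. By `adj`, any factor containing the edge has index `col x y`. -/
theorem IsDesign.existsUnique {V ι : Type*} {R : V → V → Prop} {A : ι → Set V} {c : ι → V → V}
    {col : V → V → ι} (h : IsDesign R A c col) {x y : V} (hne : x ≠ y) (hxy : R x y) :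
    ∃! i, c i x = y ∨ c i y = x := by
  refine ⟨col x y, h.link x y hxy, ?_⟩
  rintro i (rfl | rfl)
  · exact (h.adj i x hne.symm).2.1.symm
  · exact (h.adj i y hne).2.2.symm

theorem IsDesign.congr {V ι V' ι' : Type*} {R : V → V → Prop} {R' : V' → V' → Prop}
    {A : ι → Set V} {A' : ι' → Set V'} {c : ι → V → V} {col : V → V → ι}
    (h : IsDesign R A c col) (e : V ≃ V') (f : ι ≃ ι')
    (hR : ∀ x y, R' (e x) (e y) ↔ R x y) (hA : ∀ i x, e x ∈ A' (f i) ↔ x ∈ A i) :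
    IsDesign R' A' (fun i x => e (c (f.symm i) (e.symm x)))
      (fun x y => f (col (e.symm x) (e.symm y))) where
  fixed i x hx := by
    obtain ⟨i, rfl⟩ := f.surjective i
    obtain ⟨x, rfl⟩ := e.surjective x
    rw [hA] at hx
    simp [h.fixed i x hx]
  mem i x hx := by
    obtain ⟨i, rfl⟩ := f.surjective i
    obtain ⟨x, rfl⟩ := e.surjective x
    rw [hA] at hx
    simp [hA, h.mem i x hx]
  star i x hx := by
    obtain ⟨i, rfl⟩ := f.surjective i
    obtain ⟨x, rfl⟩ := e.surjective x
    rw [hA] at hx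
    simpa using (h.star i x hx).of_equiv e
  adj i x hx := by
    obtain ⟨i, rfl⟩ := f.surjective i
    obtain ⟨x, rfl⟩ := e.surjective x
    simp only [Equiv.symm_apply_apply, ne_eq, EmbeddingLike.apply_eq_iff_eq] at hx
    simpa [hR] using h.adj i x hx
  link x y hxy := by
    obtain ⟨x, rfl⟩ := e.surjective x
    obtain ⟨y, rfl⟩ := e.surjective y
    rw [hR] at hxy
    simpa using h.link x y hxy

theorem cycleType_of_involutive {v : ℕ} (hv : 0 < v) (σ : Equiv.Perm (Fin v))
    (h2 : ∀ x, σ (σ x) = x) (h0 : ∀ x, σ x ≠ x) :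
    σ.cycleType = Multiset.replicate (v / 2) 2 := by
  have ho : orderOf σ = 2 := by
    rw [orderOf_eq_prime_iff]
    refine ⟨Equiv.ext fun x => by simp [pow_two, h2], fun h => ?_⟩
    exact h0 ⟨0, hv⟩ (by rw [h]; rfl)
  obtain ⟨n, hn⟩ := Equiv.Perm.cycleType_prime_order (σ := σ) (by rw [ho]; exact Nat.prime_two)
  have hs := σ.sum_cycleType
  have hsupp : σ.support = Finset.univ := by
    ext x
    simp [h0]
  rw [hsupp, hn, ho, Finset.card_univ, Fintype.card_fin] at hs
  simp at hs
  rw [hn, ho]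
  congr 1
  omega

/-- Permutations of equal cycle type are conjugate. This is why existence for some 1-factor and for
every 1-factor coincide. -/
theorem exists_equiv_conj_of_involutive {V : Type*} [Finite V] {v : ℕ} (hv : 0 < v)
    (hV : Nat.card V = v) {τ : V → V} (hτ : ∀ x, τ (τ x) = x) (hτ0 : ∀ x, τ x ≠ x)
    {σ : Fin v → Fin v} (hσ : ∀ x, σ (σ x) = x) (hσ0 : ∀ x, σ x ≠ x) :
    ∃ e : V ≃ Fin v, ∀ x, e (τ x) = σ (e x) := by
  let e₀ : V ≃ Fin v := Finite.equivFinOfCardEq hV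
  let τ' : Equiv.Perm (Fin v) := Function.Involutive.toPerm (fun x => e₀ (τ (e₀.symm x)))
    (fun x => by simp [hτ])
  let σ' : Equiv.Perm (Fin v) := Function.Involutive.toPerm σ hσ
  have hτ' : ∀ x, τ' x = e₀ (τ (e₀.symm x)) := fun _ => rfl
  have hσ' : ∀ x, σ' x = σ x := fun _ => rfl
  have hc : IsConj τ' σ' := by
    rw [Equiv.Perm.isConj_iff_cycleType_eq, cycleType_of_involutive hv, cycleType_of_involutive hv]
    · simpa [hσ'] using hσ
    · simpa [hσ'] using hσ0
    · simp [hτ', hτ]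
    · intro x hx
      rw [hτ', ← Equiv.eq_symm_apply] at hx
      exact hτ0 _ hx
  rw [isConj_iff] at hc
  obtain ⟨g, hg⟩ := hc
  refine ⟨e₀.trans g, fun x => ?_⟩
  have := congrArg (fun p : Equiv.Perm (Fin v) => p (g (e₀ x))) hg
  simpa [hτ', hσ'] using this

/-- There is a decomposition of the complete graph on `v` vertices minus a perfect matching into
`s` 5-star factors, given by center maps. -/
def HasStarDesign (v s : ℕ) : Prop :=
  ∃ (V : Type) (σ : V → V) (c : Fin s → V → V) (col : V → V → Fin s), Nat.card V = v ∧
    (∀ x, σ (σ x) = x) ∧ (∀ x, σ x ≠ x) ∧ IsDesign (Unmatched σ) (fun _ => Set.univ) c col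

theorem HasStarDesign.exists_design {v s : ℕ} (hv : 0 < v) (h : HasStarDesign v s)
    {σ : Fin v → Fin v} (hσ : ∀ x, σ (σ x) = x) (hσ0 : ∀ x, σ x ≠ x) :
    ∃ (c : Fin s → Fin v → Fin v) (col : Fin v → Fin v → Fin s),
      IsDesign (Unmatched σ) (fun _ => Set.univ) c col := by
  obtain ⟨V, τ, c, col, hV, h1, h2, hd⟩ := h
  have : Finite V := Nat.finite_of_card_ne_zero (by omega)
  obtain ⟨e, he⟩ := exists_equiv_conj_of_involutive hv hV h1 h2 hσ hσ0
  exact ⟨_, _, hd.congr e (Equiv.refl _) (by simp [Unmatched, ← he]) (by simp)⟩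

theorem HasStarDesign.hasGraphFactorization {v s : ℕ} (hv : 0 < v) (h : HasStarDesign v s)
    {I : (SimpleGraph.completeGraph (Fin v)).Subgraph} (hI : I.IsPerfectMatching) :
    HasGraphFactorization (completeMinus I) (nStar 5) := by
  obtain ⟨σ, hσ, hσ0, hIσ⟩ := hI.exists_involution
  obtain ⟨c, col, hd⟩ := h.exists_design hv hσ hσ0
  have hc : ∀ i x, c i x ≠ x → (completeMinus I).Adj x (c i x) := fun i x hx =>
    (completeMinus_adj hIσ _ _).2 (hd.adj i x hx).1
  refine ⟨s, fun i => starFactor _ (c i) (hc i),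
    fun i => isGraphFactor_starFactor _ _ _ fun x => hd.star i x trivial,
    decomposesEdges_starFactor _ _ _ hd.idem fun x y hxy => ?_⟩
  rw [completeMinus_adj hIσ] at hxy
  exact hd.existsUnique hxy.1 hxy

theorem HasStarDesign.existsURD {v s : ℕ} (hv : 0 < v) (h : HasStarDesign v s) {σ : Fin v → Fin v}
    (hσ : ∀ x, σ (σ x) = x) (hσ0 : ∀ x, σ x ≠ x) :
    ExistsURD (SimpleGraph.completeGraph (Fin 2)) (nStar 5) v 1 s := by
  obtain ⟨c, col, hd⟩ := h.exists_design hv hσ hσ0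
  -- Each matching edge becomes a 1-star centered at its smaller end.
  let c' : Fin 1 ⊕ Fin s → Fin v → Fin v := Sum.elim (fun _ x => min x (σ x)) c
  have hmin : ∀ x, min x (σ x) = x ∨ min x (σ x) = σ x := fun x => min_choice _ _
  have hminσ : ∀ x, min (σ x) (σ (σ x)) = min x (σ x) := fun x => by rw [hσ, min_comm]
  have hadj : ∀ i x, c' i x ≠ x → (SimpleGraph.completeGraph (Fin v)).Adj x (c' i x) := by
    intro i x hx
    exact hx.symm
  have hstar : ∀ x, StarAt 1 (fun x => min x (σ x)) x := by
    intro x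
    constructor
    · rcases hmin x with h | h
      · simp only [h]
      · simp only [h, hminσ]
    · rw [show 1 + 1 = 2 from rfl, ← Set.ncard_pair (hσ0 x).symm]
      congr 1
      ext y
      simp only [Set.mem_ofPred_eq, Set.mem_insert_iff, Set.mem_singleton_iff]
      constructor
      · intro h
        rcases hmin x with hx | hx <;> rcases hmin y with hy | hy <;> rw [hx, hy] at h
        · exact Or.inl h
        · right; rw [← h, hσ]
        · exact Or.inr h
        · left; rw [← hσ x, ← h, hσ]
      · rintro (rfl | rfl)
        · rfl
        · exact hminσ x
  refine ⟨fun i => starFactor _ (c' i) (hadj i), fun i => ?_, fun i => ?_, ?_⟩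
  · obtain ⟨e⟩ := nonempty_completeGraph_two_iso
    exact (isGraphFactor_starFactor _ _ _ hstar).of_iso e
  · exact isGraphFactor_starFactor _ _ _ fun x => hd.star i x trivial
  · refine decomposesEdges_starFactor _ _ _ ?_ ?_
    · rintro (i | i) x
      · exact (hstar x).1
      · exact hd.idem i x
    · intro x y hxy
      have hne : x ≠ y := hxy
      by_cases hy : y = σ x
      · refine ⟨Sum.inl 0, ?_, ?_⟩
        · rcases hmin x with h | h
          · right
            subst hy
            change min (σ x) (σ (σ x)) = x
            rw [hminσ, h]
          · left
            subst hy
            exact h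
        · rintro (i | i) hi
          · rw [Subsingleton.elim i 0]
          · exfalso
            rcases hi with hi | hi
            · change c i x = y at hi
              have := (hd.adj i x (by rw [hi]; exact hne.symm)).1.2
              exact this (by rw [hi, hy])
            · change c i y = x at hi
              have := (hd.adj i y (by rw [hi]; exact hne)).1.2
              exact this (by rw [hi, hy, hσ])
      · obtain ⟨i, hi, hu⟩ := hd.existsUnique hne ⟨hne, hy⟩
        refine ⟨Sum.inr i, hi, ?_⟩
        rintro (j | j) hj
        · exfalso
          rcases hj with hj | hj
          · change min x (σ x) = y at hj
            rcases hmin x with h | h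
            · exact hne (h.symm.trans hj)
            · exact hy (hj.symm.trans h)
          · change min y (σ y) = x at hj
            rcases hmin y with h | h
            · exact hne (hj.symm.trans h)
            · exact hy (by rw [← hj, h, hσ])
        · rw [hu j hj]

theorem exists_perfectMatching {v : ℕ} {σ : Fin v → Fin v} (hσ : ∀ x, σ (σ x) = x)
    (hσ0 : ∀ x, σ x ≠ x) :
    ∃ I : (SimpleGraph.completeGraph (Fin v)).Subgraph, I.IsPerfectMatching := by
  refine ⟨{ verts := Set.univ, Adj := fun x y => y = σ x,
            adj_sub := ?_, edge_vert := fun _ => trivial, symm := ⟨?_⟩ }, ?_⟩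
  · rintro x _ rfl
    exact (hσ0 x).symm
  · rintro x _ rfl
    exact (hσ x).symm
  · rw [SimpleGraph.Subgraph.isPerfectMatching_iff]
    exact fun x => ⟨σ x, rfl, fun _ h => h⟩

theorem exists_fixedPointFree_involution {v : ℕ} (hv : Even v) :
    ∃ σ : Fin v → Fin v, (∀ x, σ (σ x) = x) ∧ ∀ x, σ x ≠ x := by
  rw [Nat.even_iff] at hv
  refine ⟨fun x => if h : x.1 % 2 = 0 then ⟨x.1 + 1, by omega⟩ else ⟨x.1 - 1, by omega⟩, ?_, ?_⟩
  · intro x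
    by_cases hx : x.1 % 2 = 0
    · have h1 : ¬ (x.1 + 1) % 2 = 0 := by omega
      simp [hx, h1]
    · have h1 : (x.1 - 1) % 2 = 0 := by omega
      ext
      simp only [hx, h1, dite_true, dite_false]
      omega
  · intro x h
    have := congrArg Fin.val h
    dsimp only at this
    split_ifs at this <;> simp at this
    omega

/-! ### Holed designs, frames, and filling a frame with holed designs. -/

/-- Two vertices of `S ⊕ Fin 12` are adjacent unless they are equal, matched by `σ`, or both in the
hole `Fin 12`. -/
def HoleAdj {S : Type*} (σ : S → S) : S ⊕ Fin 12 → S ⊕ Fin 12 → Prop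
  | Sum.inl x, Sum.inl y => Unmatched σ x y
  | Sum.inr _, Sum.inr _ => False
  | _, _ => True

/-- The vertex sets of the factors of a holed design: the first six factors avoid the hole. -/
def holeSupport {S T : Type*} : Fin 6 ⊕ T → Set (S ⊕ Fin 12) :=
  Sum.elim (fun _ => {x | x.isLeft}) fun _ => Set.univ

/-- A star design on `S ⊕ Fin 12` with a hole of size 12. -/
def HasHoledDesign (S T : Type) : Prop :=
  ∃ (σ : S → S) (c : Fin 6 ⊕ T → S ⊕ Fin 12 → S ⊕ Fin 12)
    (col : S ⊕ Fin 12 → S ⊕ Fin 12 → Fin 6 ⊕ T),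
    (∀ x, σ (σ x) = x) ∧ (∀ x, σ x ≠ x) ∧ IsDesign (HoleAdj σ) holeSupport c col

/-- A star design on the complete multipartite graph with parts indexed by `U`, each factor missing
one part. -/
def HasFrame (U S T : Type) : Prop :=
  ∃ (f : U × T → U × S → U × S) (col : U × S → U × S → U × T),
    IsDesign (fun x y => x.1 ≠ y.1) (fun i => {x | x.1 ≠ i.1}) f col

theorem HasHoledDesign.congr {S T S' T' : Type} (h : HasHoledDesign S T) (e : S ≃ S') (f : T ≃ T') :
    HasHoledDesign S' T' := by
  obtain ⟨σ, c, col, h1, h2, hd⟩ := h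
  refine ⟨fun x => e (σ (e.symm x)), _, _, by simp [h1], fun x => ?_,
    hd.congr (Equiv.sumCongr e (Equiv.refl _)) (Equiv.sumCongr (Equiv.refl _) f) ?_ ?_⟩
  · rw [Ne, ← Equiv.eq_symm_apply]
    exact h2 _
  · rintro (x | x) (y | y) <;> simp [HoleAdj, Unmatched]
  · rintro (i | i) (x | x) <;> simp [holeSupport]

theorem HasFrame.congr {U S T S' T' : Type} (h : HasFrame U S T) (e : S ≃ S') (f : T ≃ T') :
    HasFrame U S' T' := by
  obtain ⟨c, col, hd⟩ := h
  exact ⟨_, _, hd.congr (Equiv.prodCongr (Equiv.refl _) e) (Equiv.prodCongr (Equiv.refl _) f)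
    (by simp) (by simp)⟩

section Fill

variable {U S T : Type}

/-- The embedding of a holed design on the part `g`. -/
def liftPart (g : U) : S ⊕ Fin 12 → (U × S) ⊕ Fin 12 := Sum.map (Prod.mk g) id

theorem liftPart_injective (g : U) : Function.Injective (liftPart g : S ⊕ Fin 12 → _) :=
  Sum.map_injective.2 ⟨fun _ _ h => (Prod.mk.inj h).2, fun _ _ h => h⟩

/-- The index of a factor of the design on part `g` in the whole design. -/
def liftIndex (g : U) : Fin 6 ⊕ T → Fin 6 ⊕ (U × T) := Sum.map id (Prod.mk g)

open Classical in
/-- The center maps obtained by filling the parts of a frame with holed designs. -/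
noncomputable def fillMap (c : Fin 6 ⊕ T → S ⊕ Fin 12 → S ⊕ Fin 12) (f : U × T → U × S → U × S) :
    Fin 6 ⊕ (U × T) → (U × S) ⊕ Fin 12 → (U × S) ⊕ Fin 12
  | Sum.inl i, Sum.inl x => liftPart x.1 (c (Sum.inl i) (Sum.inl x.2))
  | Sum.inl _, Sum.inr h => Sum.inr h
  | Sum.inr j, Sum.inl x =>
    if x.1 = j.1 then liftPart j.1 (c (Sum.inr j.2) (Sum.inl x.2)) else Sum.inl (f j x)
  | Sum.inr j, Sum.inr h => liftPart j.1 (c (Sum.inr j.2) (Sum.inr h))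

open Classical in
/-- The index of the factor containing a given edge in the filled design. -/
noncomputable def fillCol (col : S ⊕ Fin 12 → S ⊕ Fin 12 → Fin 6 ⊕ T)
    (colF : U × S → U × S → U × T) : (U × S) ⊕ Fin 12 → (U × S) ⊕ Fin 12 → Fin 6 ⊕ (U × T)
  | Sum.inl x, Sum.inl y =>
    if x.1 = y.1 then liftIndex x.1 (col (Sum.inl x.2) (Sum.inl y.2)) else Sum.inr (colF x y)
  | Sum.inl x, Sum.inr h => liftIndex x.1 (col (Sum.inl x.2) (Sum.inr h))
  | Sum.inr h, Sum.inl x => liftIndex x.1 (col (Sum.inr h) (Sum.inl x.2))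
  | Sum.inr _, Sum.inr _ => Sum.inl 0

variable {σ : S → S} {c : Fin 6 ⊕ T → S ⊕ Fin 12 → S ⊕ Fin 12}
  {col : S ⊕ Fin 12 → S ⊕ Fin 12 → Fin 6 ⊕ T} {f : U × T → U × S → U × S}
  {colF : U × S → U × S → U × T}

theorem holeAdj_liftPart (g : U) (x y : S ⊕ Fin 12) :
    HoleAdj (Prod.map id σ) (liftPart g x) (liftPart g y) ↔ HoleAdj σ x y := by
  rcases x with x | x <;> rcases y with y | y <;> simp [liftPart, HoleAdj, Unmatched]

theorem fillCol_liftPart (g : U) {x y : S ⊕ Fin 12} (h : HoleAdj σ x y) :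
    fillCol col colF (liftPart g x) (liftPart g y) = liftIndex g (col x y) := by
  rcases x with x | x <;> rcases y with y | y <;> simp_all [liftPart, HoleAdj, fillCol]

theorem fillMap_liftPart (hd : IsDesign (HoleAdj σ) holeSupport c col) (g : U) (i : Fin 6 ⊕ T)
    (x : S ⊕ Fin 12) : fillMap c f (liftIndex g i) (liftPart g x) = liftPart g (c i x) := by
  rcases i with i | i <;> rcases x with x | x <;> simp only [liftIndex, liftPart, fillMap,
    Sum.map_inl, Sum.map_inr, id, if_true]
  -- What remains is one of the first six factors at a point of the hole, fixed by both maps.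
  rw [hd.fixed _ _ (by simp [holeSupport])]
  rfl

theorem HoleAdj.symm {x y : S ⊕ Fin 12} (h : HoleAdj σ x y) (hσ : ∀ x, σ (σ x) = x) :
    HoleAdj σ y x := by
  rcases x with x | x <;> rcases y with y | y
  · exact ⟨h.1.symm, fun h' => h.2 (by rw [h', hσ])⟩
  · trivial
  · trivial
  · exact h

/-- The frame factor `(g, t)` misses exactly part `g`, where it is completed by the full factor `t`
of the holed design on part `g` and the hole. Each of the first six factors is the disjoint union of
its copies on all parts. Edges between parts come from the frame, all others from the holed designs.
-/
theorem IsDesign.fill (hσ : ∀ x, σ (σ x) = x) (hd : IsDesign (HoleAdj σ) holeSupport c col)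
    (hf : IsDesign (fun x y : U × S => x.1 ≠ y.1) (fun i : U × T => {x | x.1 ≠ i.1}) f colF) :
    IsDesign (HoleAdj (Prod.map id σ)) holeSupport (fillMap c f) (fillCol col colF) := by
  have hL : ∀ g (i : Fin 6 ⊕ T) x, liftPart g x ∈ (holeSupport (liftIndex g i) : Set (U × S ⊕ _)) ↔
      x ∈ holeSupport i := by
    rintro g (i | i) (x | x) <;> simp [holeSupport, liftIndex, liftPart]
  have hout : ∀ (j : U × T) x, x.1 ≠ j.1 → fillMap c f (Sum.inr j) (Sum.inl x) = Sum.inl (f j x) :=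
    fun j x hx => by simp [fillMap, hx]
  have hfm : ∀ (j : U × T) x, x.1 ≠ j.1 → (f j x).1 ≠ j.1 := fun j x hx => hf.mem j x hx
  -- every pair of index and vertex comes from a part or from the frame
  have hcase : ∀ (i : Fin 6 ⊕ (U × T)) (x : (U × S) ⊕ Fin 12),
      (∃ g i' x', i = liftIndex g i' ∧ x = liftPart g x') ∨
      (∃ j x', i = Sum.inr j ∧ x = Sum.inl x' ∧ x'.1 ≠ j.1) ∨
      ∃ i' h, i = Sum.inl i' ∧ x = Sum.inr h := by
    rintro (i | ⟨g, t⟩) (⟨g', s⟩ | h)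
    · exact Or.inl ⟨g', Sum.inl i, Sum.inl s, rfl, rfl⟩
    · exact Or.inr (Or.inr ⟨i, h, rfl, rfl⟩)
    · by_cases hg : g' = g
      · subst hg
        exact Or.inl ⟨g', Sum.inr t, Sum.inl s, rfl, rfl⟩
      · exact Or.inr (Or.inl ⟨_, _, rfl, rfl, hg⟩)
    · exact Or.inl ⟨g, Sum.inr t, Sum.inr h, rfl, rfl⟩
  constructor
  · intro i x hx
    rcases hcase i x with ⟨g, i, x, rfl, rfl⟩ | ⟨j, x, rfl, rfl, -⟩ | ⟨i, h, rfl, rfl⟩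
    · rw [hL] at hx
      rw [fillMap_liftPart hd, hd.fixed i x hx]
    · exact absurd trivial hx
    · rfl
  · intro i x hx
    rcases hcase i x with ⟨g, i, x, rfl, rfl⟩ | ⟨j, x, rfl, rfl, -⟩ | ⟨i, h, rfl, rfl⟩
    · rw [hL] at hx
      rw [fillMap_liftPart hd, hL]
      exact hd.mem i x hx
    · trivial
    · exact hx
  · intro i x hx
    rcases hcase i x with ⟨g, i, x, rfl, rfl⟩ | ⟨j, x, rfl, rfl, hj⟩ | ⟨i, h, rfl, rfl⟩
    · rw [hL] at hx
      refine (hd.star i x hx).of_embedding (liftPart_injective g) (fillMap_liftPart hd g i) ?_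
      -- No point outside part `g` and the hole may be sent into them. In the first six factors such
      -- a point stays in its own part. In a factor `(g, t)` it is moved by the frame, whose factor
      -- avoids part `g`.
      intro w hw
      rcases hcase (liftIndex g i) w with ⟨g', i', x', h1, rfl⟩ | ⟨j, x', h1, rfl, hj⟩ |
        ⟨i', h, h1, rfl⟩
      · rcases x' with x' | x'
        · rw [h1, fillMap_liftPart hd] at hw
          obtain ⟨z, hz⟩ := hw
          rcases i' with i' | i'
          · have hm := hd.mem (Sum.inl i') (Sum.inl x') (by simp [holeSupport])
            obtain ⟨y, hy⟩ : ∃ y, c (Sum.inl i') (Sum.inl x') = Sum.inl y :=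
              Sum.isLeft_iff.1 hm
            rw [hy] at hz
            rcases z with z | z
            · have hg : g = g' := (Prod.mk.inj (Sum.inl_injective hz)).1
              subst hg
              exact ⟨_, rfl⟩
            · exact absurd hz (by simp [liftPart])
          · rcases i with i | i
            · simp [liftIndex] at h1
            · have hg : g = g' := (Prod.mk.inj (Sum.inr_injective h1)).1
              subst hg
              exact ⟨_, rfl⟩
        · exact ⟨Sum.inr x', rfl⟩
      · exfalso
        rcases i with i | i
        · simp [liftIndex] at h1
        · rw [h1, hout j x' hj] at hw
          obtain ⟨z, hz⟩ := hw
          have hg : g = j.1 := congrArg Prod.fst (Sum.inr_injective h1)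
          rcases z with z | z
          · have := congrArg Prod.fst (Sum.inl_injective hz)
            exact hfm j x' hj (this.symm.trans hg)
          · exact absurd hz (by simp [liftPart])
      · exact ⟨Sum.inr h, rfl⟩
    · have hst := hf.star j x hj
      constructor
      · rw [hout j x hj, hout j _ (hfm j x hj), hst.1]
      · refine Eq.trans ?_ hst.2
        rw [← Set.ncard_image_of_injective _ (Sum.inl_injective (α := U × S) (β := Fin 12))]
        refine congrArg Set.ncard (Set.ext fun w => ?_)
        simp only [Set.mem_ofPred_eq, Set.mem_image, hout j x hj]
        constructor
        · intro hw
          rcases hcase (Sum.inr j) w with ⟨g, i, x', h1, rfl⟩ | ⟨j', x', h1, rfl, hj'⟩ |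
            ⟨i', h, h1, rfl⟩
          · exfalso
            rw [h1, fillMap_liftPart hd] at hw
            rcases i with i | i
            · simp [liftIndex] at h1
            · have hg : j.1 = g := congrArg Prod.fst (Sum.inr_injective h1)
              rcases hz : c (Sum.inr i) x' with z | z <;> rw [hz] at hw
              · have := congrArg Prod.fst (Sum.inl_injective hw)
                exact hfm j x hj (this.symm.trans hg.symm)
              · exact absurd hw (by simp [liftPart])
          · obtain rfl := Sum.inr_injective h1
            rw [hout j x' hj'] at hw
            exact ⟨x', Sum.inl_injective hw, rfl⟩
          · exact absurd h1 (by simp)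
        · rintro ⟨y, hy, rfl⟩
          -- A point of the missing part is fixed by `f j`, so it cannot share a center with `x`.
          have hyj : y.1 ≠ j.1 := by
            intro hyj
            rw [hf.fixed j y (by simpa using hyj)] at hy
            exact hfm j x hj (by rw [← hy, hyj])
          rw [hout j y hyj, hy]
    · simp [holeSupport] at hx
  · intro i x hx
    rcases hcase i x with ⟨g, i, x, rfl, rfl⟩ | ⟨j, x, rfl, rfl, hj⟩ | ⟨i, h, rfl, rfl⟩
    · rw [fillMap_liftPart hd] at hx ⊢
      obtain ⟨h1, h2, h3⟩ := hd.adj i x fun h => hx (by rw [h])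
      have h1' := h1.symm hσ
      rw [holeAdj_liftPart, fillCol_liftPart g h1, fillCol_liftPart g h1', h2, h3]
      exact ⟨h1, rfl, rfl⟩
    · rw [hout j x hj] at hx ⊢
      obtain ⟨h1, h2, h3⟩ := hf.adj j x fun h => hx (by rw [h])
      have h1' := h1.symm
      refine ⟨⟨fun h => h1 (by rw [← h]), fun h => h1 (by rw [h]; rfl)⟩, ?_, ?_⟩
      · simp [fillCol, h1, h2]
      · simp [fillCol, h1', h3]
    · exact absurd rfl hx
  · intro x y hxy
    have hpart : ∀ g x y, HoleAdj σ x y →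
        fillMap c f (fillCol col colF (liftPart g x) (liftPart g y)) (liftPart g x) = liftPart g y ∨
        fillMap c f (fillCol col colF (liftPart g x) (liftPart g y)) (liftPart g y) =
          liftPart g x := by
      intro g x y h
      rw [fillCol_liftPart g h, fillMap_liftPart hd, fillMap_liftPart hd]
      exact (hd.link x y h).imp (congrArg _) (congrArg _)
    rcases x with ⟨g, s⟩ | x <;> rcases y with ⟨g', s'⟩ | y
    · by_cases hg : g = g'
      · subst hg
        exact hpart g (Sum.inl s) (Sum.inl s') ((holeAdj_liftPart g _ _).1 hxy)
      · have h := hf.link (g, s) (g', s') hg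
        have hc : fillCol col colF (Sum.inl (g, s)) (Sum.inl (g', s')) =
            Sum.inr (colF (g, s) (g', s')) := by simp [fillCol, hg]
        have hlink : ∀ (j : U × T) (x y : U × S), x.1 ≠ y.1 → f j x = y →
            fillMap c f (Sum.inr j) (Sum.inl x) = Sum.inl y := by
          rintro j x _ hne rfl
          refine hout j x fun h => hne ?_
          rw [hf.fixed j x (by simpa using h)]
        rw [hc]
        exact h.imp (hlink _ _ _ hg) (hlink _ _ _ (Ne.symm hg))
    · exact hpart g (Sum.inl s) (Sum.inr y) trivial
    · exact hpart g' (Sum.inr x) (Sum.inl s') trivial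
    · exact hxy.elim

end Fill

theorem HasHoledDesign.fill {U S T : Type} (h : HasHoledDesign S T) (hf : HasFrame U S T) :
    HasHoledDesign (U × S) (U × T) := by
  obtain ⟨σ, c, col, h1, h2, hd⟩ := h
  obtain ⟨f, colF, hf⟩ := hf
  refine ⟨Prod.map id σ, _, _, ?_, ?_, hd.fill h1 hf⟩
  · rintro ⟨g, s⟩
    simp [h1]
  · rintro ⟨g, s⟩ h
    exact h2 s (Prod.mk.inj h).2

/-! ### Frames from holed quasigroups and a decomposition of `K_{30,30}`. -/

/-- A commutative quasigroup on `U × K` with holes `{g} × K`. -/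
structure IsHoledQuasigroup {U K : Type} (op : U × K → U × K → U × K) : Prop where
  comm : ∀ p q, op p q = op q p
  avoid : ∀ p q, p.1 ≠ q.1 → (op p q).1 ≠ p.1
  solve : ∀ p r, r.1 ≠ p.1 → ∃ q, q.1 ≠ p.1 ∧ op p q = r
  cancel : ∀ p q q', p.1 ≠ q.1 → p.1 ≠ q'.1 → op p q = op p q' → q = q'

/-- A decomposition of `K_{30,30}` into 18 star factors. -/
def HasBipartiteDesign : Prop :=
  ∃ (c : Fin 18 → Bool × Fin 30 → Bool × Fin 30) (col : Bool × Fin 30 → Bool × Fin 30 → Fin 18),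
    IsDesign (fun x y => x.1 ≠ y.1) (fun _ => Set.univ) c col

section Frame

variable {U K : Type} {op : U × K → U × K → U × K}

open Classical in
/-- The solution `q` of `op p q = r`. -/
noncomputable def IsHoledQuasigroup.div (hop : IsHoledQuasigroup op) (r p : U × K) : U × K :=
  if h : r.1 ≠ p.1 then (hop.solve p r h).choose else p

theorem IsHoledQuasigroup.div_fst_ne (hop : IsHoledQuasigroup op) {r p : U × K} (h : r.1 ≠ p.1) :
    (hop.div r p).1 ≠ p.1 := by
  rw [div, dif_pos h]
  exact (hop.solve p r h).choose_spec.1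

theorem IsHoledQuasigroup.op_div (hop : IsHoledQuasigroup op) {r p : U × K} (h : r.1 ≠ p.1) :
    op p (hop.div r p) = r := by
  rw [div, dif_pos h]
  exact (hop.solve p r h).choose_spec.2

theorem IsHoledQuasigroup.div_op (hop : IsHoledQuasigroup op) {p q : U × K} (h : p.1 ≠ q.1) :
    hop.div (op p q) p = q := by
  have h' := hop.avoid p q h
  exact hop.cancel p _ _ (hop.div_fst_ne h').symm h (hop.op_div h')

theorem IsHoledQuasigroup.fst_div_ne (hop : IsHoledQuasigroup op) {r p : U × K} (h : r.1 ≠ p.1) :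
    r.1 ≠ (hop.div r p).1 := by
  have := hop.avoid (hop.div r p) p (hop.div_fst_ne h)
  rwa [hop.comm, hop.op_div h] at this

/-- By commutativity, `hop.div r` is an involution outside the part of `r`. It matches points of
different parts. -/
theorem IsHoledQuasigroup.div_div (hop : IsHoledQuasigroup op) {r p : U × K} (h : r.1 ≠ p.1) :
    hop.div r (hop.div r p) = p := by
  have := hop.div_op (hop.div_fst_ne h)
  rwa [hop.comm, hop.op_div h] at this

variable (ν : U × K → ℕ) (c : Fin 18 → Bool × Fin 30 → Bool × Fin 30)
  (col : Bool × Fin 30 → Bool × Fin 30 → Fin 18)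

/-- Whether `p` precedes `q`. -/
def side (p q : U × K) : Bool := decide (ν p < ν q)

/-- The embedding of `K_{30,30}` on the blown up points `p` and `q`. -/
def pairEmb (p q : U × K) (z : Bool × Fin 30) : (U × K) × Fin 30 :=
  (if z.1 = side ν p q then p else q, z.2)

open Classical in
/-- The center maps of the frame obtained from a holed quasigroup. -/
noncomputable def frameMap (hop : IsHoledQuasigroup op) (j : (U × K) × Fin 18)
    (x : (U × K) × Fin 30) : (U × K) × Fin 30 :=
  if j.1.1 = x.1.1 then x else
    pairEmb ν x.1 (hop.div j.1 x.1) (c j.2 (side ν x.1 (hop.div j.1 x.1), x.2))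

/-- The index of the factor containing a given edge of the frame. -/
def frameCol (op : U × K → U × K → U × K) (x y : (U × K) × Fin 30) : (U × K) × Fin 18 :=
  (op x.1 y.1, col (side ν x.1 y.1, x.2) (side ν y.1 x.1, y.2))

variable {ν c col}

theorem side_swap (hν : Function.Injective ν) {p q : U × K} (h : p ≠ q) :
    side ν q p = !side ν p q := by
  have := hν.ne h
  by_cases h' : ν p < ν q
  · simp [side, h', h'.le]
  · simp [side, h', show ν q < ν p by omega]

/-- The copy of `K_{30,30}` depends only on the unordered pair, so both ends see the same factor.
The numbering `ν` exists only to orient pairs consistently. -/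
theorem pairEmb_swap (hν : Function.Injective ν) {p q : U × K} (h : p ≠ q) (z : Bool × Fin 30) :
    pairEmb ν q p z = pairEmb ν p q z := by
  rw [pairEmb, pairEmb, side_swap hν h]
  rcases side ν p q <;> rcases z with ⟨_ | _, z⟩ <;> simp

theorem pairEmb_injective {p q : U × K} (h : p ≠ q) : Function.Injective (pairEmb ν p q) := by
  rintro ⟨a, s⟩ ⟨b, t⟩ hab
  simp only [pairEmb, Prod.mk.injEq] at hab ⊢
  refine ⟨?_, hab.2⟩
  have h' := hab.1
  by_cases ha : a = side ν p q <;> by_cases hb : b = side ν p q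
  · rw [ha, hb]
  · rw [if_pos ha, if_neg hb] at h'
    exact absurd h' h
  · rw [if_neg ha, if_pos hb] at h'
    exact absurd h'.symm h
  · revert ha hb
    rcases a <;> rcases b <;> rcases side ν p q <;> simp

/-- Over each matched pair the frame factor is a copy of a factor of `K_{30,30}`. This reduces the
design axioms of the frame to those of `c`. -/
theorem frameMap_pairEmb (hν : Function.Injective ν) (hop : IsHoledQuasigroup op)
    (j : (U × K) × Fin 18) {p : U × K} (h : j.1.1 ≠ p.1) (z : Bool × Fin 30) :
    frameMap ν c hop j (pairEmb ν p (hop.div j.1 p) z) =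
      pairEmb ν p (hop.div j.1 p) (c j.2 z) := by
  have hne : p ≠ hop.div j.1 p := fun h' => hop.div_fst_ne h (by rw [← h'])
  obtain ⟨b, s⟩ := z
  by_cases hb : b = side ν p (hop.div j.1 p)
  · have : pairEmb ν p (hop.div j.1 p) (b, s) = (p, s) := by simp [pairEmb, hb]
    rw [this, frameMap, if_neg h, hb]
  · have : pairEmb ν p (hop.div j.1 p) (b, s) = (hop.div j.1 p, s) := by simp [pairEmb, hb]
    rw [this, frameMap, if_neg (hop.fst_div_ne h)]
    simp only [hop.div_div h]
    rw [pairEmb_swap hν hne, side_swap hν hne]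
    congr 3
    revert hb
    rcases b <;> rcases side ν p (hop.div j.1 p) <;> simp

theorem pairEmb_side {p q : U × K} (s : Fin 30) : pairEmb ν p q (side ν p q, s) = (p, s) := by
  simp [pairEmb]

theorem pairEmb_side' (hν : Function.Injective ν) {p q : U × K} (h : p ≠ q) (s : Fin 30) :
    pairEmb ν p q (side ν q p, s) = (q, s) := by
  rw [← pairEmb_swap hν h, pairEmb_side]

theorem isDesign_frame (hν : Function.Injective ν) (hop : IsHoledQuasigroup op)
    (hd : IsDesign (fun x y => x.1 ≠ y.1) (fun _ => Set.univ) c col) :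
    IsDesign (fun x y : (U × K) × Fin 30 => x.1.1 ≠ y.1.1)
      (fun j : (U × K) × Fin 18 => {x | x.1.1 ≠ j.1.1}) (frameMap ν c hop) (frameCol ν col op) := by
  have hne : ∀ {r p : U × K}, r.1 ≠ p.1 → p ≠ hop.div r p := fun h h' =>
    hop.div_fst_ne h (by rw [← h'])
  have hrep : ∀ (j : (U × K) × Fin 18) (x : (U × K) × Fin 30), j.1.1 ≠ x.1.1 →
      ∃ z, x = pairEmb ν x.1 (hop.div j.1 x.1) z := fun j x _ => ⟨_, pairEmb_side x.2 |>.symm⟩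
  have hrange : ∀ (j : (U × K) × Fin 18) (p : U × K), j.1.1 ≠ p.1 → ∀ z,
      j.1.1 ≠ (pairEmb ν p (hop.div j.1 p) z).1.1 := by
    intro j p h z
    rw [pairEmb]
    dsimp only
    split_ifs
    · exact h
    · exact hop.fst_div_ne h
  constructor
  · intro j x hx
    rw [frameMap, if_pos]
    simpa [eq_comm] using hx
  · intro j x hx
    have hx : j.1.1 ≠ x.1.1 := Ne.symm hx
    rw [frameMap, if_neg hx]
    exact (hrange j x.1 hx _).symm
  · intro j x hx
    have hx : j.1.1 ≠ x.1.1 := Ne.symm hx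
    obtain ⟨p, s⟩ := x
    have hst := (hd.star j.2 (side ν p (hop.div j.1 p), s) trivial).of_embedding
      (pairEmb_injective (ν := ν) (hne hx)) (frameMap_pairEmb (c := c) hν hop j hx) ?_
    · rwa [pairEmb_side] at hst
    · rintro ⟨q, t⟩ ⟨z, hz⟩
      by_cases hq : j.1.1 = q.1
      · rw [frameMap, if_pos hq] at hz
        exact ⟨z, hz⟩
      · rw [frameMap, if_neg hq] at hz
        dsimp only at hz
        have h1 := congrArg Prod.fst hz
        simp only [pairEmb] at h1
        have hd1 := hop.div_div hx
        have hd2 := hop.div_div hq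
        -- The pairs matched by `j.1` are disjoint, so sharing one point makes them equal.
        have : q = p ∨ q = hop.div j.1 p := by
          split_ifs at h1
          · exact Or.inl h1.symm
          · right; rw [h1, hd2]
          · exact Or.inr h1.symm
          · left; rw [← hd2, ← h1, hd1]
        rcases this with rfl | rfl
        · exact ⟨_, pairEmb_side t⟩
        · exact ⟨_, pairEmb_side' hν (hne hx) t⟩
  · intro j x hx
    have hj : j.1.1 ≠ x.1.1 := fun h => hx (by rw [frameMap, if_pos h])
    obtain ⟨p, s⟩ := x
    have hpq : p ≠ hop.div j.1 p := hne hj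
    rw [frameMap, if_neg hj] at hx ⊢
    set q := hop.div j.1 p with hq
    have hz : c j.2 (side ν p q, s) ≠ (side ν p q, s) := fun h => hx (by
      dsimp only
      rw [h, pairEmb_side])
    obtain ⟨h1, h2, h3⟩ := hd.adj _ _ hz
    obtain ⟨t, ht⟩ : ∃ t, c j.2 (side ν p q, s) = (side ν q p, t) := by
      refine ⟨(c j.2 (side ν p q, s)).2, Prod.ext ?_ rfl⟩
      rw [side_swap hν hpq]
      revert h1
      rcases side ν p q <;> rcases (c j.2 _).1 <;> simp
    dsimp only
    rw [ht] at h2 h3 ⊢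
    rw [pairEmb_side' hν hpq]
    refine ⟨(hop.div_fst_ne hj).symm, ?_, ?_⟩
    · rw [frameCol]
      dsimp only
      rw [h2, hop.op_div hj]
    · rw [frameCol]
      dsimp only
      rw [h3, hop.comm, hop.op_div hj]
  · rintro ⟨p, s⟩ ⟨q, t⟩ hpq
    have hpq : p.1 ≠ q.1 := hpq
    have hne : p ≠ q := fun h => hpq (by rw [h])
    have h1 : (op p q).1 ≠ p.1 := hop.avoid p q hpq
    have key := frameMap_pairEmb (c := c) hν hop (frameCol ν col op (p, s) (q, t)) h1
    have hdiv : hop.div (frameCol ν col op (p, s) (q, t)).1 p = q := hop.div_op hpq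
    rw [hdiv] at key
    have h2 := key (side ν p q, s)
    have h3 := key (side ν q p, t)
    rw [pairEmb_side] at h2
    rw [pairEmb_side' hν hne] at h3
    rw [h2, h3]
    refine (hd.link (side ν p q, s) (side ν q p, t) ?_).imp (fun h => ?_) (fun h => ?_)
    · simp [side_swap hν hne]
    · exact (congrArg (pairEmb ν p q) h).trans (pairEmb_side' hν hne t)
    · exact (congrArg (pairEmb ν p q) h).trans (pairEmb_side s)

theorem hasFrame_of_isHoledQuasigroup [Finite U] [Finite K] (hb : HasBipartiteDesign)
    (hop : IsHoledQuasigroup op) : HasFrame U (K × Fin 30) (K × Fin 18) := by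
  obtain ⟨c, col, hd⟩ := hb
  obtain ⟨n, ⟨e⟩⟩ := Finite.exists_equiv_fin (U × K)
  have hν : Function.Injective fun p => (e p).1 := Fin.val_injective.comp e.injective
  exact ⟨_, _, (isDesign_frame hν hop hd).congr (Equiv.prodAssoc _ _ _) (Equiv.prodAssoc _ _ _)
    (by simp) (by simp)⟩

end Frame

/-! ### Existence of holed quasigroups, and the recursion on `k`. -/

/-- The blow-up of a holed quasigroup by an abelian group. -/
theorem IsHoledQuasigroup.blowUp {U K : Type} {op : U × K → U × K → U × K}
    (hop : IsHoledQuasigroup op) (A : Type) [AddCommGroup A] :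
    ∃ op' : U × (K × A) → U × (K × A) → U × (K × A), IsHoledQuasigroup op' := by
  refine ⟨fun p q => ((op (p.1, p.2.1) (q.1, q.2.1)).1, (op (p.1, p.2.1) (q.1, q.2.1)).2,
    p.2.2 + q.2.2), ?_, ?_, ?_, ?_⟩
  · rintro ⟨u, k, a⟩ ⟨u', k', a'⟩
    simp [hop.comm (u, k), add_comm]
  · rintro ⟨u, k, a⟩ ⟨u', k', a'⟩ h
    exact hop.avoid (u, k) (u', k') h
  · rintro ⟨u, k, a⟩ ⟨u', k', a'⟩ h
    obtain ⟨q, h1, h2⟩ := hop.solve (u, k) (u', k') h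
    exact ⟨(q.1, q.2, a' - a), h1, by simp [h2]⟩
  · rintro ⟨u, k, a⟩ ⟨v, l, b⟩ ⟨v', l', b'⟩ h h' he
    simp only [Prod.mk.injEq] at he
    obtain ⟨h1, h2, h3⟩ := he
    have := hop.cancel (u, k) (v, l) (v', l') h h' (Prod.ext h1 h2)
    simp_all

/-- The operation is the midpoint in `Z_u`, where 2 is invertible; the midpoint of distinct points
differs from both. -/
theorem exists_isHoledQuasigroup_odd {u : ℕ} (hu : Odd u) :
    ∃ op : ZMod u × Unit → ZMod u × Unit → ZMod u × Unit, IsHoledQuasigroup op := by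
  obtain ⟨m, hm⟩ := hu
  -- The inverse of 2, since `2(m + 1) = u + 1`.
  let w : ZMod u := m + 1
  have hw : w * 2 = 1 := by
    have : ((2 * m + 1 : ℕ) : ZMod u) = 0 := by rw [← hm]; simp
    push_cast at this
    linear_combination this
  refine ⟨fun p q => (w * (p.1 + q.1), ()), ?_, ?_, ?_, ?_⟩
  · intro p q
    simp [add_comm]
  · rintro ⟨p, _⟩ ⟨q, _⟩ h h'
    refine h ?_
    have h' : w * (p + q) = p := h'
    linear_combination (p + q) * hw - 2 * h'
  · rintro ⟨p, _⟩ ⟨r, _⟩ h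
    refine ⟨(2 * r - p, ()), fun h' => h ?_, ?_⟩
    · have h' : 2 * r - p = p := h'
      change r = p
      linear_combination w * h' - (r - p) * hw
    · refine Prod.ext ?_ rfl
      change w * (p + (2 * r - p)) = r
      linear_combination r * hw
  · rintro ⟨p, _⟩ ⟨q, _⟩ ⟨q', _⟩ - - he
    have he : w * (p + q) = w * (p + q') := congrArg Prod.fst he
    refine Prod.ext ?_ rfl
    change q = q'
    linear_combination 2 * he - (q - q') * hw

/-- Points are read as residues `n = p.1 + 4 * p.2` modulo 8, with holes `{n, n + 4}`, and the
product of `n` and `m` is `n + t(m - n)` for the listed table `t`. It is commutative because `t(d) =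
d + t(-d)`, and `t` permutes the residues other than 0 and 4. The table entries at 0 and 4 and the
value `(0, 0)` are placeholders. -/
theorem exists_isHoledQuasigroup_four :
    ∃ op : Fin 4 × Fin 2 → Fin 4 × Fin 2 → Fin 4 × Fin 2, IsHoledQuasigroup op := by
  let g : ℕ → Fin 4 × Fin 2 := fun n => (Fin.ofNat 4 n, Fin.ofNat 2 (n / 4))
  refine ⟨fun p q => if p.1 = q.1 then (0, 0) else
    g (p.1 + 4 * p.2 + [0, 7, 3, 5, 0, 2, 1, 6].getD ((q.1 + 4 * q.2 + 8 - p.1 - 4 * p.2) % 8) 0),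
    ?_, ?_, ?_, ?_⟩ <;> decide +kernel

theorem HasHoledDesign.mul {k u : ℕ} {U K : Type} [Finite U] [Finite K]
    (h : HasHoledDesign (Fin (30 * k)) (Fin (18 * k))) (hb : HasBipartiteDesign)
    (hU : Nat.card U = u) (hK : Nat.card K = k) {op : U × K → U × K → U × K}
    (hop : IsHoledQuasigroup op) :
    HasHoledDesign (Fin (30 * (u * k))) (Fin (18 * (u * k))) := by
  have hf := hasFrame_of_isHoledQuasigroup hb hop
  have e1 : K × Fin 30 ≃ Fin (30 * k) := Finite.equivFinOfCardEq (by simp [hK, mul_comm])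
  have e2 : K × Fin 18 ≃ Fin (18 * k) := Finite.equivFinOfCardEq (by simp [hK, mul_comm])
  refine (h.fill (hf.congr e1 e2)).congr (Finite.equivFinOfCardEq ?_) (Finite.equivFinOfCardEq ?_)
  · simp [hU, mul_left_comm]
  · simp [hU, mul_left_comm]

/-- The cases 2 and 4 must be given. With two parts no product can avoid both holes, and four parts
of size one leave three points outside a hole, which cannot be paired. -/
theorem hasHoledDesign_of_base (hb : HasBipartiteDesign)
    (h1 : HasHoledDesign (Fin 30) (Fin 18)) (h2 : HasHoledDesign (Fin 60) (Fin 36))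
    (h4 : HasHoledDesign (Fin 120) (Fin 72)) (k : ℕ) (hk : 0 < k) :
    HasHoledDesign (Fin (30 * k)) (Fin (18 * k)) := by
  induction k using Nat.strong_induction_on with | _ k ih => ?_
  obtain ⟨a, u, hu, rfl⟩ := Nat.exists_eq_two_pow_mul_odd hk.ne'
  have hu0 : 0 < u := hu.pos
  have : NeZero u := ⟨hu0.ne'⟩
  have hpow : 0 < 2 ^ a := by positivity
  by_cases hu1 : u = 1
  · subst hu1
    match a with
    | 0 => exact h1
    | 1 => exact h2
    | 2 => exact h4
    | b + 3 =>
      -- Here `2 ^ (b + 3) = 4 * 2 ^ (b + 1)`: four parts, each a hole of size 2 blown up by `2 ^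
      -- b`.
      have hpos : 0 < 2 ^ b := by positivity
      have : NeZero (2 ^ b) := ⟨hpos.ne'⟩
      obtain ⟨op, hop⟩ := exists_isHoledQuasigroup_four
      obtain ⟨op, hop⟩ := hop.blowUp (ZMod (2 ^ b))
      have := (ih (2 ^ (b + 1)) (by rw [pow_succ, pow_succ 2 (b + 2), pow_succ]; omega)
        (by positivity)).mul hb (u := 4) (Nat.card_fin 4) (by simp [pow_succ, mul_comm]) hop
      convert this using 3 <;> ring
  -- With odd `u > 1`, take `u` parts whose holes of size 1 are blown up to `2 ^ a`.
  · obtain ⟨op, hop⟩ := exists_isHoledQuasigroup_odd hu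
    obtain ⟨op, hop⟩ := hop.blowUp (ZMod (2 ^ a))
    have : NeZero (2 ^ a) := ⟨hpow.ne'⟩
    rw [mul_comm (2 ^ a)]
    refine (ih (2 ^ a) ?_ hpow).mul hb (Nat.card_zmod u) (by simp) hop
    have : 2 ≤ u := by omega
    nlinarith

/-! ### Verifying designs listed as runs of six vertices, center first. -/

theorem starAt_fin_six (x : Fin 6) : StarAt 5 (fun _ : Fin 6 => (0 : Fin 6)) x :=
  ⟨rfl, by simp [Set.ncard_univ]⟩

/-- The center map of the factor whose blocks are the runs of six consecutive entries of the
sequence `ρ 0, …, ρ (M - 1)`, where `π` is the inverse of `ρ`. -/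
def runMap {N : ℕ} [NeZero N] (M : ℕ) (ρ π : ℕ → ℕ) (x : Fin N) : Fin N :=
  if x.1 < M then Fin.ofNat N (ρ (6 * (π x / 6))) else x

section RunMap

variable {N M : ℕ} [NeZero N] {ρ π : ℕ → ℕ}

theorem exists_of_leftInverse (hρ : ∀ j < M, ρ j < M ∧ π (ρ j) = j) {x : ℕ} (hx : x < M) :
    ∃ j < M, ρ j = x := by
  let f : Fin M → Fin M := fun j => ⟨ρ j, (hρ j j.2).1⟩
  have hf : Function.Injective f := fun i j h => by
    have h' : ρ i = ρ j := congrArg Fin.val h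
    ext
    rw [← (hρ i i.2).2, h', (hρ j j.2).2]
  obtain ⟨j, hj⟩ := Finite.injective_iff_surjective.1 hf ⟨x, hx⟩
  exact ⟨j, j.2, congrArg Fin.val hj⟩

theorem runMap_val (hM : M ≤ N) (hρ : ∀ j < M, ρ j < M ∧ π (ρ j) = j) {x : Fin N} (j : ℕ)
    (hj : j < M) (hx : x.1 = ρ j) : (runMap M ρ π x).1 = ρ (6 * (j / 6)) := by
  have h1 := (hρ j hj).1
  have h2 := (hρ (6 * (j / 6)) (by omega)).1
  rw [runMap, if_pos (by omega), hx, (hρ j hj).2, Fin.val_ofNat, Nat.mod_eq_of_lt (by omega)]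

/-- The run through `x` is an embedded copy of the model star on `Fin 6` centered at 0, and distinct
runs are disjoint because `ρ` is injective. -/
theorem starAt_runMap (hM : M ≤ N) (h6 : 6 ∣ M) (hρ : ∀ j < M, ρ j < M ∧ π (ρ j) = j) {x : Fin N}
    (hx : x.1 < M) : StarAt 5 (runMap M ρ π) x := by
  obtain ⟨j, hj, hjx⟩ := exists_of_leftInverse hρ hx
  have hb : ∀ r : Fin 6, 6 * (j / 6) + r < M := fun r => by omega
  let f : Fin 6 → Fin N := fun r => ⟨ρ (6 * (j / 6) + r), (hρ _ (hb r)).1.trans_le hM⟩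
  have hrun : ∀ r, (runMap M ρ π (f r)).1 = ρ (6 * (j / 6)) := fun r => by
    rw [runMap_val hM hρ _ (hb r) rfl]
    congr 2
    omega
  have key := (starAt_fin_six ⟨j % 6, by omega⟩).of_embedding (f := f) (d := runMap M ρ π) ?_ ?_ ?_
  · convert key
    ext
    rw [← hjx]
    change ρ j = ρ (6 * (j / 6) + j % 6)
    rw [Nat.div_add_mod]
  · intro r s h
    have h' : ρ (6 * (j / 6) + r) = ρ (6 * (j / 6) + s) := congrArg Fin.val h
    have := (hρ _ (hb r)).2
    rw [h', (hρ _ (hb s)).2] at this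
    ext
    omega
  · intro r
    ext
    rw [hrun]
    rfl
  · rintro w ⟨r, hr⟩
    have hr : ρ (6 * (j / 6) + r) = (runMap M ρ π w).1 := congrArg Fin.val hr
    have hw : w.1 < M := by
      by_contra hw
      rw [runMap, if_neg hw] at hr
      have := (hρ _ (hb r)).1
      omega
    obtain ⟨l, hl, hlw⟩ := exists_of_leftInverse hρ hw
    rw [runMap_val hM hρ l hl hlw.symm] at hr
    have := (hρ _ (hb r)).2
    rw [hr, (hρ _ (by omega)).2] at this
    refine ⟨⟨l % 6, by omega⟩, ?_⟩
    ext
    change ρ (6 * (j / 6) + l % 6) = w.1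
    rw [← hlw]
    congr 1
    omega

end RunMap

/-- The conjunction of `p k` for `k < n`. -/
def allBelow (n : ℕ) (p : ℕ → Bool) : Bool := n.rec true fun k ih => p k && ih

theorem allBelow_eq_true {n : ℕ} {p : ℕ → Bool} :
    allBelow n p = true ↔ ∀ k < n, p k = true := by
  induction n with
  | zero => simp [allBelow]
  | succ n ih =>
    change (p n && allBelow n p) = true ↔ _
    rw [Bool.and_eq_true, ih, Nat.forall_lt_succ_right, and_comm]

theorem not_beq_eq_true {x y : ℕ} : (!x.beq y) = true ↔ x ≠ y := by
  rw [Bool.not_eq_true', ← Bool.not_eq_true, Nat.beq_eq]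

theorem not_blt_eq_true {x y : ℕ} : (!x.blt y) = true ↔ ¬ x < y := by
  rw [Bool.not_eq_true', ← Bool.not_eq_true, Nat.blt_eq]

/-- `π i` is the inverse of `ρ i` on the numbers below `M i`. -/
def checkInverse (s : ℕ) (M : ℕ → ℕ) (ρ π : ℕ → ℕ → ℕ) : Bool :=
  allBelow s fun i => allBelow (M i) fun j => (ρ i j).blt (M i) && (π i (ρ i j)).beq j

/-- The edges of the `i`-th factor satisfy `R` and have color `i`. -/
def checkEdges (s : ℕ) (M : ℕ → ℕ) (ρ col : ℕ → ℕ → ℕ) (R : ℕ → ℕ → Bool) : Bool :=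
  allBelow s fun i => allBelow (M i) fun j => (j % 6).beq 0 ||
    (R (ρ i j) (ρ i (6 * (j / 6))) && (col (ρ i j) (ρ i (6 * (j / 6)))).beq i &&
      (col (ρ i (6 * (j / 6))) (ρ i j)).beq i)

/-- The vertices `x` and `y` are joined in the factor given by their color. -/
def checkLinks (N s : ℕ) (M : ℕ → ℕ) (ρ π col : ℕ → ℕ → ℕ) (R : ℕ → ℕ → Bool) : Bool :=
  allBelow N fun x => allBelow x fun y => !R x y || ((col x y).blt s &&
    (x.blt (M (col x y)) && (ρ (col x y) (6 * (π (col x y) x / 6))).beq y ||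
      y.blt (M (col x y)) && (ρ (col x y) (6 * (π (col x y) y / 6))).beq x))

/-- `checkInverse` makes the runs partition each support, `checkEdges` gives `adj`, and `checkLinks`
gives `link` for `y < x`; the other order follows from the symmetry of colors on edges. -/
theorem isDesign_of_runs {N s : ℕ} [NeZero N] [NeZero s] (M : ℕ → ℕ) (ρ π col : ℕ → ℕ → ℕ)
    (R : ℕ → ℕ → Bool) (hR : ∀ x < N, ∀ y < N, R x y = true → x ≠ y ∧ R y x = true)
    (hM : ∀ i < s, M i ≤ N ∧ 6 ∣ M i) (hinv : checkInverse s M ρ π = true)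
    (hedge : checkEdges s M ρ col R = true) (hlink : checkLinks N s M ρ π col R = true) :
    IsDesign (fun x y : Fin N => R x y = true) (fun i : Fin s => {x | x.1 < M i})
      (fun i => runMap (M i) (ρ i) (π i)) (fun x y => Fin.ofNat s (col x y)) := by
  have hρ : ∀ i < s, ∀ j < M i, ρ i j < M i ∧ π i (ρ i j) = j := by
    simpa [checkInverse, allBelow_eq_true] using hinv
  have hadj : ∀ i < s, ∀ j < M i, j % 6 ≠ 0 → R (ρ i j) (ρ i (6 * (j / 6))) = true ∧
      col (ρ i j) (ρ i (6 * (j / 6))) = i ∧ col (ρ i (6 * (j / 6))) (ρ i j) = i := by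
    intro i hi j hj hj6
    have h : checkEdges s M ρ col R = true := hedge
    simp only [checkEdges, allBelow_eq_true, Bool.or_eq_true, Bool.and_eq_true, Nat.beq_eq] at h
    exact ((h i hi j hj).resolve_left hj6).elim fun h h' => ⟨h.1, h.2, h'⟩
  have hadj' : ∀ (i : Fin s) (x : Fin N), runMap (M i) (ρ i) (π i) x ≠ x →
      R x (runMap (M i) (ρ i) (π i) x).1 = true ∧
      Fin.ofNat s (col x (runMap (M i) (ρ i) (π i) x).1) = i ∧
      Fin.ofNat s (col (runMap (M i) (ρ i) (π i) x).1 x) = i := by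
    intro i x hx
    have hx' : x.1 < M i := by
      by_contra h
      exact hx (if_neg h)
    obtain ⟨j, hj, hjx⟩ := exists_of_leftInverse (hρ i i.2) hx'
    have hval := runMap_val (hM i i.2).1 (hρ i i.2) j hj hjx.symm
    have hj6 : j % 6 ≠ 0 := by
      intro h
      refine hx (Fin.ext ?_)
      rw [hval, ← hjx]
      congr 1
      omega
    obtain ⟨h1, h2, h3⟩ := hadj i i.2 j hj hj6
    rw [hval, ← hjx, h2, h3]
    exact ⟨h1, by simp, by simp⟩
  have hlt : ∀ x y : Fin N, y.1 < x.1 → R x y = true →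
      runMap (M (Fin.ofNat s (col x y)).1) (ρ (Fin.ofNat s (col x y)).1)
        (π (Fin.ofNat s (col x y)).1) x = y ∨
      runMap (M (Fin.ofNat s (col x y)).1) (ρ (Fin.ofNat s (col x y)).1)
        (π (Fin.ofNat s (col x y)).1) y = x := by
    intro x y hyx hxy
    have h : checkLinks N s M ρ π col R = true := hlink
    simp only [checkLinks, allBelow_eq_true, Bool.or_eq_true, Bool.and_eq_true, Nat.beq_eq,
      Nat.blt_eq, Bool.not_eq_true'] at h
    obtain ⟨h1, h2⟩ := (h x x.2 y hyx).resolve_left (by simp [hxy])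
    have hc : (Fin.ofNat s (col x y)).1 = col x y := by
      rw [Fin.val_ofNat, Nat.mod_eq_of_lt h1]
    rw [hc]
    refine h2.imp ?_ ?_
    all_goals
      rintro ⟨h, h'⟩
      ext
      rw [runMap, if_pos h, h', Fin.val_ofNat, Nat.mod_eq_of_lt (Fin.is_lt _)]
  refine ⟨fun i x hx => if_neg hx, fun i x hx => ?_,
    fun i x hx => starAt_runMap (hM i i.2).1 (hM i i.2).2 (hρ i i.2) hx, hadj', fun x y hxy => ?_⟩
  · obtain ⟨j, hj, hjx⟩ := exists_of_leftInverse (hρ i i.2) hx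
    rw [Set.mem_ofPred_eq, runMap_val (hM i i.2).1 (hρ i i.2) j hj hjx.symm]
    exact (hρ i i.2 _ (by omega)).1
  · obtain ⟨hne, hyx⟩ := hR x x.2 y y.2 hxy
    rcases Nat.lt_or_gt_of_ne hne with h | h
    · have key := hlt y x h hyx
      -- The pair is an edge of the factor `col y x`, and edges of a factor have its color in both
      -- orders.
      have hcol : Fin.ofNat s (col y x) = Fin.ofNat s (col x y) := by
        rcases key with hk | hk
        · have := (hadj' (Fin.ofNat s (col y x)) y fun h' => hne (by rw [← hk, h'])).2.2
          rw [hk] at this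
          exact this.symm
        · have := (hadj' (Fin.ofNat s (col y x)) x fun h' => hne (by rw [← h', hk])).2.1
          rw [hk] at this
          exact this.symm
      rw [← hcol]
      exact key.symm
    · exact hlt x y h hxy

/-- The `j`-th digit in base 256 of the `i`-th entry of a table. -/
def entry (T : List ℕ) (i j : ℕ) : ℕ := T.getD i 0 / 256 ^ j % 256

/-- Translation by `e` in each block of `n` consecutive integers. -/
def rotate (n e x : ℕ) : ℕ := n * (x / n) + (x % n + e) % n

/-- Translation by half a block in each block of `n` consecutive integers. -/
def antipode (m n : ℕ) [NeZero m] (x : Fin m) : Fin m := Fin.ofNat m (rotate n (n / 2) x)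
-- The design on 12 vertices, and filling the hole with it.
/-- Adjacency in the complete graph on 12 vertices minus the antipodal pairs. -/
def cocktailAdj (x y : ℕ) : Bool := !(x.beq y) && !(y.beq ((x + 6) % 12))

/-- Modulo 12, factor `i` joins `i` to `i+1, …, i+5` and `i+6` to `i+7, …, i+11`. The center of an
edge is the end from which the other is reached by 1 to 5 steps forward. -/
theorem isDesign_fin_twelve : IsDesign (fun x y : Fin 12 => cocktailAdj x y = true)
    (fun _ : Fin 6 => {x | x.1 < 12})
    (fun i : Fin 6 => runMap 12 (fun j => (j + i) % 12) (fun x => (x + 12 - i) % 12))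
    (fun x y => Fin.ofNat 6 (if (y.1 + 12 - x) % 12 < 6 then x.1 % 6 else y.1 % 6)) :=
  isDesign_of_runs (fun _ => 12) (fun i j => (j + i) % 12) (fun i x => (x + 12 - i) % 12)
    (fun x y => if (y + 12 - x) % 12 < 6 then x % 6 else y % 6) cocktailAdj
    (by decide +kernel) (by decide) (by decide +kernel) (by decide +kernel) (by decide +kernel)

theorem cocktailAdj_eq_true {x y : Fin 12} :
    cocktailAdj x y = true ↔ x ≠ y ∧ y ≠ ⟨(x.1 + 6) % 12, by omega⟩ := by
  simp only [cocktailAdj, Bool.and_eq_true, not_beq_eq_true, Fin.ext_iff, ne_eq]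

theorem HasHoledDesign.hasStarDesign {k : ℕ} (h : HasHoledDesign (Fin (30 * k)) (Fin (18 * k))) :
    HasStarDesign (30 * k + 12) (18 * k + 6) := by
  obtain ⟨σ, c, col, h1, h2, hd⟩ := h
  have h0 := isDesign_fin_twelve
  set c₀ : Fin 6 → Fin 12 → Fin 12 :=
    fun i => runMap 12 (fun j => (j + i) % 12) (fun x => (x + 12 - i) % 12)
  set col₀ : Fin 12 → Fin 12 → Fin 6 :=
    fun x y => Fin.ofNat 6 (if (y.1 + 12 - x) % 12 < 6 then x.1 % 6 else y.1 % 6)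
  let c' : Fin 6 ⊕ Fin (18 * k) → Fin (30 * k) ⊕ Fin 12 → Fin (30 * k) ⊕ Fin 12
    | Sum.inl i, Sum.inr x => Sum.inr (c₀ i x)
    | i, x => c i x
  let col' : Fin (30 * k) ⊕ Fin 12 → Fin (30 * k) ⊕ Fin 12 → Fin 6 ⊕ Fin (18 * k)
    | Sum.inr x, Sum.inr y => Sum.inl (col₀ x y)
    | x, y => col x y
  let σ' : Fin (30 * k) ⊕ Fin 12 → Fin (30 * k) ⊕ Fin 12 :=
    Sum.map σ fun x => ⟨(x.1 + 6) % 12, by omega⟩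
  have hleft : ∀ i x, ∃ y, c (Sum.inl i) (Sum.inl x) = Sum.inl y := fun i x =>
    Sum.isLeft_iff.1 (hd.mem (Sum.inl i) (Sum.inl x) rfl)
  have hright : ∀ i x, c (Sum.inl i) (Sum.inr x) = Sum.inr x := fun i x =>
    hd.fixed _ _ (by simp [holeSupport])
  have hd' : IsDesign (Unmatched σ') (fun _ => Set.univ) c' col' := by
    refine ⟨fun i x hx => absurd trivial hx, fun _ _ _ => trivial, ?_, ?_, ?_⟩
    · rintro (i | t) (x | x) -
      · obtain ⟨y, hy⟩ := hleft i x
        have hst := hd.star (Sum.inl i) (Sum.inl x) rfl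
        have hy' : c' (Sum.inl i) (Sum.inl x) = Sum.inl y := hy
        rw [StarAt, hy] at hst
        rw [StarAt, hy']
        -- Both `c` and `c'` keep the hole points inside the hole, so the fiber outside it is
        -- unchanged.
        refine ⟨hst.1, hst.2.symm ▸ congrArg Set.ncard (Set.ext fun w => ?_)⟩
        rcases w with w | w
        · rfl
        · simp [c', hright]
      · exact (h0.star i x x.2).of_embedding (f := Sum.inr) Sum.inr_injective (fun _ => rfl)
          fun w ⟨z, hz⟩ => by
            rcases w with w | w
            · obtain ⟨y, hy⟩ := hleft i w
              exact absurd (hz.trans hy) (by simp)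
            · exact ⟨w, rfl⟩
      · exact hd.star (Sum.inr t) (Sum.inl x) trivial
      · exact hd.star (Sum.inr t) (Sum.inr x) trivial
    · have hmain : ∀ i x, c i x ≠ x → Unmatched σ' x (c i x) ∧ col' x (c i x) = i ∧
          col' (c i x) x = i := by
        intro i x hx
        have h := hd.adj i x hx
        revert h
        generalize c i x = y
        rcases x with x | x <;> rcases y with y | y
        · simp [HoleAdj, Unmatched, σ', col']
        · simp [HoleAdj, Unmatched, σ', col']
        · simp [HoleAdj, Unmatched, σ', col']
        · exact fun h => h.1.elim
      rintro (i | t) (x | x) hx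
      · exact hmain _ _ hx
      · have hx' : c₀ i x ≠ x := fun h => hx (congrArg Sum.inr h)
        obtain ⟨h3, h4, h5⟩ := h0.adj i x hx'
        rw [cocktailAdj_eq_true] at h3
        exact ⟨⟨fun h => hx h.symm, fun h => h3.2 (Sum.inr_injective h)⟩,
          congrArg Sum.inl h4, congrArg Sum.inl h5⟩
      · exact hmain _ _ hx
      · exact hmain _ _ hx
    · have hmain : ∀ x y, HoleAdj σ x y → c' (col x y) x = y ∨ c' (col x y) y = x := by
        intro x y hxy
        have hcc : ∀ i x, c i x ≠ x → c' i x = c i x := by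
          rintro (i | i) (x | x) h
          · rfl
          · exact absurd (hright i x) h
          · rfl
          · rfl
        have hne : x ≠ y := by
          rintro rfl
          rcases x with x | x
          · exact hxy.1 rfl
          · exact hxy
        refine (hd.link x y hxy).imp (fun h => ?_) fun h => ?_
        · rw [hcc _ _ (by rw [h]; exact hne.symm), h]
        · rw [hcc _ _ (by rw [h]; exact hne), h]
      rintro (x | x) (y | y) hxy
      · exact hmain _ _ ⟨fun h => hxy.1 (congrArg _ h), fun h => hxy.2 (congrArg Sum.inl h)⟩
      · exact hmain (Sum.inl x) (Sum.inr y) trivial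
      · exact hmain (Sum.inr x) (Sum.inl y) trivial
      · refine (h0.link x y ?_).imp (congrArg Sum.inr) (congrArg Sum.inr)
        rw [cocktailAdj_eq_true]
        exact ⟨fun h => hxy.1 (congrArg Sum.inr h), fun h => hxy.2 (congrArg Sum.inr h)⟩
  let f : Fin 6 ⊕ Fin (18 * k) ≃ Fin (18 * k + 6) := Finite.equivFinOfCardEq (by simp [add_comm])
  refine ⟨_, σ', _, _, by simp, ?_, ?_, hd'.congr (Equiv.refl _) f (by simp) (by simp)⟩
  · rintro (x | x)
    · simp [σ', h1]
    · simp only [σ', Sum.map_inr]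
      congr 1
      ext
      dsimp only
      omega
  · rintro (x | x) h
    · exact h2 x (Sum.inl_injective h)
    · have := congrArg Fin.val (Sum.inr_injective h)
      dsimp only at this
      omega

/-! ### Criteria for explicit holed and bipartite designs. -/

/-- Adjacency in the complete graph on `m + 12` vertices minus the last 12 of them and the
antipodal pairs. -/
def holeAdjNat (m n x y : ℕ) : Bool :=
  (x.blt m || y.blt m) && !(x.beq y) &&
    (!(x.blt m) || !(y.blt m) || !(y.beq (rotate n (n / 2) x)))

theorem holeAdjNat_eq_true {m n x y : ℕ} : holeAdjNat m n x y = true ↔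
    (x < m ∨ y < m) ∧ x ≠ y ∧ (x < m → y < m → y ≠ rotate n (n / 2) x) := by
  simp only [holeAdjNat, Bool.and_eq_true, Bool.or_eq_true, Nat.blt_eq, not_beq_eq_true,
    not_blt_eq_true]
  tauto

/-- The hole is the last 12 vertices, so the first six factors permute only the numbers below `m`.
The hypothesis `hσ` makes the antipode a fixed-point-free involution. -/
theorem hasHoledDesign_of_runs {m t : ℕ} [NeZero m] (n : ℕ) (ρ π col : ℕ → ℕ → ℕ) (hm : 6 ∣ m)
    (hσ : ∀ x < m, rotate n (n / 2) x < m ∧ rotate n (n / 2) x ≠ x ∧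
      rotate n (n / 2) (rotate n (n / 2) x) = x)
    (hinv : checkInverse (6 + t) (fun i => bif i.blt 6 then m else m + 12) ρ π = true)
    (hedge : checkEdges (6 + t) (fun i => bif i.blt 6 then m else m + 12) ρ col
      (holeAdjNat m n) = true)
    (hlink : checkLinks (m + 12) (6 + t) (fun i => bif i.blt 6 then m else m + 12) ρ π col
      (holeAdjNat m n) = true) :
    HasHoledDesign (Fin m) (Fin t) := by
  have : NeZero (6 + t) := ⟨by omega⟩
  have hsymm : ∀ x < m + 12, ∀ y < m + 12, holeAdjNat m n x y = true →
      x ≠ y ∧ holeAdjNat m n y x = true := by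
    intro x _ y _ h
    rw [holeAdjNat_eq_true] at h ⊢
    refine ⟨h.2.1, h.1.symm, h.2.1.symm, fun hy hx h' => h.2.2 hx hy ?_⟩
    rw [h', (hσ y hy).2.2]
  have hd := isDesign_of_runs (fun i => bif i.blt 6 then m else m + 12) ρ π col (holeAdjNat m n)
    (s := 6 + t) (N := m + 12) hsymm
    (by intro i _; cases h : i.blt 6 <;> simp only [cond_true, cond_false] <;> omega)
    hinv hedge hlink
  have hval : ∀ x : Fin m, (antipode m n x).1 = rotate n (n / 2) x := fun x => by
    rw [antipode, Fin.val_ofNat, Nat.mod_eq_of_lt (hσ x x.2).1]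
  refine ⟨antipode m n, _, _, fun x => ?_, fun x h => ?_,
    hd.congr finSumFinEquiv.symm finSumFinEquiv.symm ?_ ?_⟩
  · ext
    rw [hval, hval, (hσ x x.2).2.2]
  · exact (hσ x x.2).2.1 ((hval x).symm.trans (congrArg Fin.val h))
  · intro x y
    obtain ⟨x, rfl⟩ := finSumFinEquiv.surjective x
    obtain ⟨y, rfl⟩ := finSumFinEquiv.surjective y
    rw [Equiv.symm_apply_apply, Equiv.symm_apply_apply, holeAdjNat_eq_true]
    rcases x with x | x <;> rcases y with y | y
    · simp [HoleAdj, Unmatched, Fin.ext_iff, hval]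
    · have := x.2
      simp [HoleAdj]
      omega
    · have := y.2
      simp [HoleAdj]
      omega
    · simp [HoleAdj]
  · intro i x
    obtain ⟨x, rfl⟩ := finSumFinEquiv.surjective x
    obtain ⟨i, rfl⟩ := finSumFinEquiv.surjective i
    rw [Equiv.symm_apply_apply, Equiv.symm_apply_apply]
    have hblt : ∀ a, a < 6 → Nat.blt a 6 = true := fun a h => by rwa [Nat.blt_eq]
    have hblt' : ∀ a, Nat.blt (6 + a) 6 = false := fun a => by
      rw [Bool.eq_false_iff, Ne, Nat.blt_eq]
      omega
    rcases x with x | x <;> rcases i with i | i <;> simp [holeSupport, hblt, hblt']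

theorem hasBipartiteDesign_of_runs (ρ π col : ℕ → ℕ → ℕ)
    (hinv : checkInverse 18 (fun _ => 60) ρ π = true)
    (hedge : checkEdges 18 (fun _ => 60) ρ col (fun x y => !(x / 30).beq (y / 30)) = true)
    (hlink : checkLinks 60 18 (fun _ => 60) ρ π col (fun x y => !(x / 30).beq (y / 30)) = true) :
    HasBipartiteDesign := by
  have hb : ∀ x y : ℕ, (!(x / 30).beq (y / 30)) = true ↔ x / 30 ≠ y / 30 := fun x y =>
    not_beq_eq_true
  have hd := isDesign_of_runs (fun _ => 60) ρ π col (fun x y => !(x / 30).beq (y / 30)) (s := 18)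
    (N := 60) (fun x _ y _ h => by
      rw [hb] at h ⊢
      exact ⟨fun h' => h (by rw [h']), h.symm⟩) (by decide) hinv hedge hlink
  let e : Fin 60 ≃ Bool × Fin 30 :=
    (finProdFinEquiv (m := 2) (n := 30)).symm.trans (Equiv.prodCongr finTwoEquiv (Equiv.refl _))
  refine ⟨_, _, hd.congr e (Equiv.refl _) ?_ ?_⟩
  · intro x y
    rw [hb]
    simp only [e, Equiv.trans_apply, Equiv.prodCongr_apply, Prod.map, ne_eq,
      EmbeddingLike.apply_eq_iff_eq, Fin.ext_iff]
    exact Iff.rfl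
  · simp

/-! ### Explicit base designs. -/

/-- The base factors of a design on `K_{30,30}`, as sequences of vertices in base 256. -/
def bipartiteRuns : List ℕ := [
  709659044410683048170516793650001880882453714611966718584437387582776986341582366816752905701075983300703170293201342692361626440878390165309225,
  171488170629484310601856517991940022503978448015589401822700137536810265966298530317094611870864423898190746079029755976450909767431095966698545,
  489543332333116085107638348004029463749815144525887474152305681433504750374117799331225403212620944582524974513940773367781358303366878156161080,
  636258225568695128605448860129954344765972387853660111782017166036288124496982898547088873844555502962206990675180913545677946999887098415228685,
  220260853088694904658845356172886627963176664069291145624494398658013509976374889097371030875129714283282470049923901901583959049127129121098270,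
  392705992020435118968849312468816325715203776450520981018930323936332899211957027233663652719594920487980426604371958257712299447432748484008740]

/-- The inverses of the sequences in `bipartiteRuns`. -/
def bipartitePositions : List ℕ := [
  685697575942681311061579920851983755125509648369355641602131406456430974830179452574871713895073693797688692298185737459914403788757029920178975,
  330296750240682642570292000163995292976661076660864745443838268591676230439340197706987356895392502303047289527594245226520013017671585545860870,
  123381815537396052815958123787404361093054031944582750708758344773060722786874667717023753445400639972413572482415669452871566593313122959503105,
  670974724283628571483941891104725316431033833601142519962834160500022806581672682486236423931664123831706564070634476539229368720566201194064685,
  635067751663049409801396361090936164139374108561118268127528319300797701770164458489821711866100284831899875995601855721900996505923729888977170,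
  575230581322468196612634445874234083099936573303180927583054134111049288178857035585302454628006185456879528672221398395759180886302862478346290]

/-- The factors containing the edges at the first vertex of each block, for a design on `K_{30,30}`. -/
def bipartiteColors : List ℕ := [
  207875786494227094924204197727307750668637304383984851461120435295837013510931941176823991327929397517305870984184702716859594651063591660158976,
  122374802202040209085300795201618129809167540843359984655428239801725593661220051063882580676254061475778735045353921555503400951007752264613888,
  85646123102822647192766127629002416938355030381868801729958672157413257447964372674933504146085644480785532982837711663293768139112403590709248,
  85648164091513391466961219319881311198696253176324465212084362976928288365813622993944858409626016019743628412928748037310319183651670652354560,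
  134424376011604704438163659789638438102425031222047790263409358726384493414307226624005722838104373844707200705535995856696457700271203775676416,
  147096349089370099020709284782835154809975229629103086676939355517346592536502028430108019085915365846956413314151521768135366831803324245737472,
  195493336553461737703514686583032271629527789404528133512273951031284647883697004000064942303955442152617961761575293787445486012695309163954176,
  110513169275852235277919482814746191011245968318360683117601597312086154581750419070790586553607997913225302095291798749211015501472868346101760,
  98318834642986652606055483105162750872009679309540794531482961872790115043277244476357858171496207620425387520215600842528959847869518538866688,
  36678643549719064881736589929658800757478933485858728854041376502069082785062719127801641043074173179666941813248159933913924343804645873811456,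
  82930589146476437166397679396383313537297098630208711694410222210649347,
  62116667424195474474360528385965067045955095695336687212392857291654663,
  110537364731719804626544264597417116487832095055776270825258260642729230,
  41437543772006346614596658470075305993037914148319295704930324234437644,
  27930821513229671060861676591275577430295941141014319841685235349324036,
  69152475480971013006913787531720750905336013137039942193629354393209349,
  7307941635987709853038531481366462740862836605560961618318872405214215,
  103877312143236188334975363903596878341716677536676201712928291916417039,
  48716944091185963176520596371202177772434971050368295842802893802833676,
  7009802938395638561018110369126704693084882024786473994734250652208899]

/-- A group of order 3 rotates each block of three consecutive vertices, turning six base factors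
into 18. Colors are stored only for the first vertex of each block; for other edges, rotate back,
look up, and rotate the index. -/
theorem hasBipartiteDesign : HasBipartiteDesign :=
  hasBipartiteDesign_of_runs
    (fun i j => rotate 3 (i % 3) (entry bipartiteRuns (i / 3) j))
    (fun i x => entry bipartitePositions (i / 3) (rotate 3 (3 - i % 3) x))
    (fun x y => rotate 3 (x % 3) (entry bipartiteColors (x / 3) (rotate 3 (3 - x % 3) y)))
    (by decide +kernel) (by decide +kernel) (by decide +kernel)

/-- The base factors of a design on 42 vertices, as sequences of vertices in base 256. -/
def smallHoledRuns : List ℕ := [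
  152297477564022460624096790473739704037590934334961915942886329644941850,
  62223561479660827752135226535910937781353221649758079268149649909220615,
  5004751223787750438069766189266356819334905102261207729741268067525873796425295390336571485359249956,
  4957634648385977360310091036009052028542649021664809951327689463469502557090298862856840303394759196,
  21379095421088058315974973799274547023661472802061598935376408393837960602071932931764040140302588966,
  1676984329854520145723489894632082072771793011878563475472324764541506915160954878811021165564724501,
  572720618112721729898480015993655485759539716852724970797611275233119414326709953107948477470546186,
  17028089861381873868215019589009780759689769207878989265040265934984299965717463794949652556673191206]

/-- The inverses of the sequences in `smallHoledRuns`. -/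
def smallHoledPositions : List ℕ := [
  69395113371577856128885762170099058880443901166264355561383817912587525,
  172626439088432101760794446585838038437752016684153935422631838242706715,
  11004939414226200063449775859467137904743867059610460406764901331032505500050785565741847076152543506,
  19721769008251200709131437478666821858746276299283700157615181987771420174577846423967185022112442121,
  20249499193114091859023612037738805585144943537342302159036624249517644933144275667762327436694193191,
  18632515518344650559443219277917798489075313358615639610054854617529664974515174710700178556676017176,
  4381168880694538402239831618736428822024092864031964659549256538116030302646971822215092600927693086,
  4453716536138897231298135723355099217221850874935263052737612575714575953589402891452401390788481831]

/-- The factors containing the edges at the first vertex of each block, for a design on 42 vertices. -/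
def smallHoledColors : List ℕ := [
  3304522687023290044474757360474818273529212348241672861442539845974160321199003352728380137207173120,
  12044956770892488370564033296143288471416142839486309485483851551800454513044189104282230837524698624,
  6581076476294996184159636446650001577520951963242625540652257035037625000722183579873934752716165900,
  4942841561726595395606389756745628175789137738410826875814094593095655262944714451676666931991810070,
  4942849612856149435325120615352182230073887514377463454794465928262023463531652659456536782252872966,
  9876887687543029288634229423733846286684624573701856394127062838037824963686860153003839764914638601,
  11504501499851488283329696306149819416009928589506043863500956530725536034812434870679899874122993670,
  7130058651728490002296260251074478906830280022351011268015754154761973941459214337927537597614458642,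
  8772624434392992039865719402567329070488482332573965023071482729085538635138615860218867522320007425,
  9308757050932535611317645319402711051591049706388461032159731985229241964411912777730842572347343636,
  76487584811796559075188681302797123074077966125819640490384973710232326,
  138521372666007344745586325325282011456441401880975343585311248899642127,
  90074342745771627809301441269847319274107107330416662592503894680342290,
  55619953799880516861938334144739140989882201899896608477515276901549842]

/-- The symmetry has order 3 again, with eight base factors. The first two, of length 30, yield the
six factors avoiding the hole. The matching joins points at distance 3 in blocks of six, so rotation
preserves it. -/
theorem hasHoledDesign_thirty : HasHoledDesign (Fin 30) (Fin 18) :=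
  hasHoledDesign_of_runs 6
    (fun i j => rotate 3 (i % 3) (entry smallHoledRuns (i / 3) j))
    (fun i x => entry smallHoledPositions (i / 3) (rotate 3 (3 - i % 3) x))
    (fun x y => rotate 3 (x % 3) (entry smallHoledColors (x / 3) (rotate 3 (3 - x % 3) y)))
    (by decide) (by decide +kernel) (by decide +kernel) (by decide +kernel) (by decide +kernel)

/-- The base factor and the translation giving the `i`-th factor of a design with a cyclic
automorphism of order 12. -/
def cyclicIndex (i : ℕ) : ℕ × ℕ := bif i.blt 6 then (0, i) else (1 + (i - 6) / 12, (i - 6) % 12)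

/-- The index of the translate by `z` of the `i`-th factor. -/
def translateIndex (z i : ℕ) : ℕ := bif i.blt 6 then (i + z) % 6 else 6 + rotate 12 z (i - 6)

/-- The base factors of a design on 72 vertices, as sequences of vertices in base 256. -/
def mediumHoledRuns : List ℕ := [
  269808679264089592952600270013526758331390977625328829124106090324348960093429285326368689266549345377027215015113532262646808193185360286452265,
  44480762535304986001283493836089938606205221723253080108584637408043821104312745513377890670113205398249237018182196366658489495305040262876512478014774312123496273910439211,
  38895329252915052430274178887557036204967874540282172228906123967127448095110536646858926278928121845754596704168836904295578621227905151904753930465802302244844925441934611,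
  65761917876787661995368650678726750427689533044024838828073376587294712856636032824364031169905226761360640802587753030256580456478452812769234659006545075538689159197504806]

/-- The inverses of the sequences in `mediumHoledRuns`. -/
def mediumHoledPositions : List ℕ := [
  488542454354340323480746269505354499366401419847837916108528647123918346034725414258842441651145605154312667984334984405969693122230441104119090,
  53299967387627151413840484210997592487440410538680844832513723957954938747012044900146991179371394734304168202684258111345019703546110221874225229189990891591415184052732186,
  30203419680246207823795979562207760587498328729144236865872106067758971866202564707201201211184986122974199946759579068705182292780392561140915932294854769271318660181463811,
  55224676357708586605633634412969539689692080315825670022343288106256844619918140340477662642773950893698083119408009892075573051069857145167300169494857971543027893684481831]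

/-- The factors containing the edges at the first vertex of each block, for a design on 72 vertices. -/
def mediumHoledColors : List ℕ := [
  12597812053852172309322069878734729303903272960004954429465312163246883744056509304198759872495531370171798572324975701062762680889382362920345748736319020304214116975057664,
  24225389595693190643459335760905414850140078096342317851607049101584005890825488162562124201296409740864220420220306043821383619882942786644863696378545779913337700146676997,
  39672174154294981582157960417963737850564400702674820166490714538023299089539235396114809780296394473797917972255064333238889076545428126141512287616591881931804268574676002,
  36739627922941772993487286526214460282169246689703737168500029873152532549015715500704642129090348078791634892122677288469762459834042680856872994794804041143073331728813863,
  34886995838166184939825196817702488899141512478791445001904934305748363248911417881418588485457468882477358581720830593660195943743155699364810201750432927935667889577069581,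
  390934215006739533594487796662011479338825581261847962688462624301790473401422653243268754099675566173449702682145622544830496648680901937204756]

/-- The symmetry has order 12. The first base factor is invariant under the half turn, so its
translates are just the six factors avoiding the hole; the other three have 12 translates each. -/
theorem hasHoledDesign_sixty : HasHoledDesign (Fin 60) (Fin 36) :=
  hasHoledDesign_of_runs 12
    (fun i j => rotate 12 (cyclicIndex i).2 (entry mediumHoledRuns (cyclicIndex i).1 j))
    (fun i x => entry mediumHoledPositions (cyclicIndex i).1 (rotate 12 (12 - (cyclicIndex i).2) x))
    (fun x y => translateIndex (x % 12)
      (entry mediumHoledColors (x / 12) (rotate 12 (12 - x % 12) y)))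
    (by decide) (by decide +kernel) (by decide +kernel) (by decide +kernel) (by decide +kernel)

/-- The base factors of a design on 132 vertices, as sequences of vertices in base 256. -/
def largeHoledRuns : List ℕ := [
  2606325932476897394154977432193639210431381955360467852180184149015998160817079342646538047304841706245076579479613912845142107452342388474229699465060561678347599334718170945082614407634372633772276062829351712376675336615242047078646586750945537516036053555041610123155574437979871081575,
  263432596414665666708433448472769520793461403840683160900598690966225460490029444714691641017580666005627421031971966154334371307939264569263981703164977701116698295737301456986182670028557505476848327758738165825912472017169436949409597233340355579634398221987338718724750942596654339038372958181385281143470446356846,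
  392262385895493608274571418717560684487890585359958016705532161876693901960408713036709044311034488517609360017624242704680171310671300155525160334957405991970188011936312108900521871215275871207397538559190414238444819155150692214188974523557050643765907825785991621863296462233705517910373823670787035222737687167611,
  329128915926557278154826681855115955484292465181735214166832670199900108532440127116954562533291047501266006131820529086260513026289192696783688621154618901466326402716566970784214404115846575166446776808475216710944726773273897357621341897791415748951885467233135832895472808071493207858754356556651696319049325047566,
  347318200719103491620375695792980090661921166177828536321089345353620976779599739547319067507184290088904005209320492282715716128001357099423782188742581236901517932131983143219355070463681347561796392941620772274902842581841011314686128210735314801770761134676709118605880550926734224412447382008668666840154368731226,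
  164151969263872226923337403132583423075509835624985291182878124437504476114014205188210495967807862574500600238826375589755623459314801226526348782372923941947260773606026419498447242631940044678305918057054824672504946892339751834743508455870755137938240578781422303306427357818883871644605732116279335360561599444076,
  305541749800141620857682778561302237956094426734830009726409055729722151377687548889182392890712022296753338755674888640212093451352840120345091634253820330091043691632007704520439174342342255470891181816723092824118333160861594789826127646075160570683188803251713874078241372950076329610801928123489502323249642502191]

/-- The inverses of the sequences in `largeHoledRuns`. -/
def largeHoledPositions : List ℕ := [
  4501996552048172171303042334540439188015266899814969544153372556553715662566131949516623044464151996489149697406621191395129838210340140170772536708605313812370868791716378924206200149049266691958677828745529242449755785069512196189567112579661962149692154840346422544753797299543166822700,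
  100213601990084840371192262009413892750875746520043222899595269283782379492682093042653269645873766597961283140894862364293072383080748933845955911035230148218408797973864171892802271352487045187027078661782456978499452416369837152349315802743989744460308793749575838886292090556126150759289669443171694026723969336596,
  224733131371596132985206194572314394987975172395458936857124041857098987886443956878510508771882712765578006312552789717485737601524949651830517848030383025734490668782377377908308354005916340102272556122464174497776062880649092058856665148478235734674159478768754743095144929408600820766669615150653594351453379251286,
  90941214611235253123719119531000720477455355530105795647796092925973275513088829889767410755004666751158090876371192277283850096323777385455234451319038749192751441986058186360336534065073169026161127673774828831076788461209888616039633910395492735585481986407854588865936708928230105959640720630929555330116325570841,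
  128170370725385229785718238696099477026371011125159873317864506761882167624416945109627048142694005426463471529577939389094522815102582667838841202594727487130495862336923526128402681919455551530581219166201736810439052362253831255514972349499494359532971040792377775574529700540765681043773972178070180483154816493626,
  348022536860455682878783570203549131390046673866860976586286308435655101168004051421127643804883834010948751077687229425680738502949979956621780874816149149305762677226484476222422970771283283593177974944615658063679198172924254092270688936547648211731228648336287791416534329517251806252184055033246646221595945954426,
  212270087960811802528094621903086225169815203076688440941585328443446332294000824364802025958161343460655607279058244743503286308923374808102756644116783105501304345780236470274745507909447776483301050784093292868707010162234806222959571558274396679079969122946676949790769986887346119420401057240075346529718413826866]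

/-- The factors containing the edges at the first vertex of each block, for a design on 132 vertices. -/
def largeHoledColors : List ℕ := [
  160642000384898519095531267005118098634499117551999405370604243654979884860225795473568811915829105172336828333745618323309110699474220889111666130514780542107410427778011445965687582769752820415654835439896283189798008238359335631980152781148276360810735886127674654025650569097272680613561566924106202067828535462912,
  184274683604069971826110501675639141951489211496323700474855430923507732003298856772191222998601315686995100924408094479564259694616073168244059277821950839950868163596279995466701408488460148063512068716752230291853776359716167103328494311157188314719932156031107589435168994790727667555072101951652435603783145623614,
  115257477831579441120371927433401581913306470998969224068858995138649107982133514590497879628217277512819401946683099431840354515520825155166534563933990067576579838829616361780357957610617872556921379438111226687669990037365378918819265609322464258853783824069838391385580888483365685984949429864945412958786279839810,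
  109048561398982035495299881975868957356400969737511882417188674779191120482891485473388864918162018479213796505204279711285001013524549762186007555037633969976106236960888662138382859711234693844605589990548255323348481870168352336841286807107175073252689207356332776075208809946630621514634439991183539267102494757916,
  214258384201095298680340095454665324926454504874138445011819134861491313882456922634203244555114689672226938372931021005347824603186388284550737075682489112406145156528992023950854629786354086423697672502046155254712402141053016246583961003649164489752145218852852640906685781223386829870497821926453122949651073343812,
  166153654740978635895264389709214027326517851266689102181176743102798659824575419107506556713838477041285104605319178606121615895002458826021169971326917492713551971178115044572258299989566554949066211895436382905313518903102047466730987051918496249601710150239126984763304630744130101239595615788305750116351048957761,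
  42873579994880081221386242523412810281283699551730767311615363144257693940234560062392365327487040875765397765495261987865181578224801697262011444833952984357548345035768526948584943859847505236069100923828138672286527996348680045885290129965638953284370636749550174605917346857014713715209743943282460415637357480509,
  96716699832430821892865219956903026438857445977063770619288419023259670738848716102883952942785677864278929796003010074068993189468547476903575892995139912500371019193982096897466560273134018901340880303204580920684400871814687526628056095367517020388501581955806588856073129477914533885655619419688685251748341219621,
  61030179448347234857677310837877767919571313778149106096864503784622421924105182754092516568642118142340050700231828066481247360062682026879059314202526700688202926009612667306246002731005434279261130712207293740491438156622507085230822268278611802702690685789585860860176896028455052336706458749991897420011969720894,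
  190246859463942790156174403850412329827757543114456395737824770641514295319760120267253212058104901732961076846523745946709360053813806323917451966265453129999970644951303946277000349791333779709872652274404241637145201953455060920711287602359422896536214279993641672847984164367375618312260302437220120112109553388052,
  1529256353056420259045944864083601315652257347317338797583126640844433788801109105721731560530418198312943918268433280309897431961326210836522594851870946653979703189574021887519609099841823395787551422941361479708401926006754039409895121693736899576450442285825650257644533818066410482241]

/-- The same symmetry as for 60, with six base factors having 12 translates each. -/
theorem hasHoledDesign_oneHundredTwenty : HasHoledDesign (Fin 120) (Fin 72) :=
  hasHoledDesign_of_runs 12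
    (fun i j => rotate 12 (cyclicIndex i).2 (entry largeHoledRuns (cyclicIndex i).1 j))
    (fun i x => entry largeHoledPositions (cyclicIndex i).1 (rotate 12 (12 - (cyclicIndex i).2) x))
    (fun x y => translateIndex (x % 12)
      (entry largeHoledColors (x / 12) (rotate 12 (12 - x % 12) y)))
    (by decide) (by decide +kernel) (by decide +kernel) (by decide +kernel) (by decide +kernel)

/-! ### Assembly. -/

theorem hasStarDesign (k : ℕ) : HasStarDesign (30 * k + 12) (18 * k + 6) := by
  rcases Nat.eq_zero_or_pos k with rfl | hk
  · refine ⟨Fin 12, fun x => ⟨(x.1 + 6) % 12, by omega⟩, _, _, by simp, by decide, by decide,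
      isDesign_fin_twelve.congr (Equiv.refl _) (Equiv.refl _) (fun x y => ?_) fun i x => ?_⟩
    · exact cocktailAdj_eq_true.symm
    · simp
  · refine HasHoledDesign.hasStarDesign ?_
    exact hasHoledDesign_of_base hasBipartiteDesign hasHoledDesign_thirty hasHoledDesign_sixty
      hasHoledDesign_oneHundredTwenty k hk

theorem mainTheorem1 (v : ℕ) (hv : 0 < v) (hv2 : v ≠ 2) :
    ((∃ I : (SimpleGraph.completeGraph (Fin v)).Subgraph, I.IsPerfectMatching ∧
        HasGraphFactorization (completeMinus I) (nStar 5)) ↔ v ≡ 12 [MOD 30]) ∧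
    (∀ I : (SimpleGraph.completeGraph (Fin v)).Subgraph, I.IsPerfectMatching →
      (HasGraphFactorization (completeMinus I) (nStar 5) ↔ v ≡ 12 [MOD 30])) ∧
    (∀ s : ℕ, ExistsURD (SimpleGraph.completeGraph (Fin 2)) (nStar 5) v 1 s ↔
      v ≡ 12 [MOD 30] ∧ 5 * s + 6 = 3 * v) := by
  have key : v ≡ 12 [MOD 30] → ∃ k, v = 30 * k + 12 := fun h => by
    rw [Nat.ModEq] at h
    exact ⟨v / 30, by omega⟩
  refine ⟨⟨?_, ?_⟩, fun I hI => ⟨modEq_of_hasGraphFactorization hv hv2 hI, ?_⟩,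
    fun s => ⟨modEq_of_existsURD hv hv2, ?_⟩⟩
  · rintro ⟨I, hI, h⟩
    exact modEq_of_hasGraphFactorization hv hv2 hI h
  · intro h
    obtain ⟨k, rfl⟩ := key h
    obtain ⟨σ, hσ, hσ0⟩ := exists_fixedPointFree_involution (v := 30 * k + 12)
      (by rw [Nat.even_iff]; omega)
    obtain ⟨I, hI⟩ := exists_perfectMatching hσ hσ0
    exact ⟨I, hI, (hasStarDesign k).hasGraphFactorization hv hI⟩
  · intro h
    obtain ⟨k, rfl⟩ := key h
    exact (hasStarDesign k).hasGraphFactorization hv hI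
  · rintro ⟨h, hs⟩
    obtain ⟨k, rfl⟩ := key h
    obtain rfl : s = 18 * k + 6 := by omega
    obtain ⟨σ, hσ, hσ0⟩ := exists_fixedPointFree_involution (v := 30 * k + 12)
      (by rw [Nat.even_iff]; omega)
    exact (hasStarDesign k).existsURD hv hσ hσ0
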